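/- Let $q>1$ and $r\in\mathbb{R}$, and write $B_R=\{x\in\mathbb{R}^2:|x|<R\}$. A singular solution of $-\Delta u=f(u)$ on $B_R\setminus\{0\}$ ($R>0$) is a nonnegative function $u\in C^2(B_R\setminus\{0\})$ that satisfies the equation pointwise in $B_R\setminus\{0\}$ and such that $u(x)\to\infty$ as $x\to0$. There exist $R>0$ and a positive, radially symmetric singular solution $u\in C^\infty(B_R\setminus\{0\})$ of $$-\Delta u=u^r e^{u^q}\quad\text{in } B_R\setminus\{0\}$$ satisfying $$u(x)=\bigg(\log\frac1{|x|^2}-\frac{2q+r-1}{q}\log\log\frac1{|x|^2}+\log\frac{4(q-1)}{q^2}\bigg)^{\frac1q}+O\bigg(\frac{\log(-\log|x|)}{(-\log|x|)^{2-\frac1q}}\bigg)\quad\text{as } |x|\to0.$$ For $q=2$, $r=1$ the explicit term and the order of the remainder are, for $0<|x|<1$, respectively $$\big(-2\log|x|-2\log(-\log|x|)-2\log2\big)^{1/2}\quad\text{and}\quad\frac{\log(-\log|x|)}{(-\log|x|)^{3/2}},$$ which are those of the singular solution of $-\Delta u=u(e^{u^2}-1)$ constructed by Ibrahim, Kikuchi,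 Nakanishi and Wei. -/

import Mathlib

open scoped Topology ContDiff Asymptotics

/-- The Euclidean plane. -/
abbrev Plane : Type := EuclideanSpace ℝ (Fin 2)

/-- The punctured disc of radius `R` about the origin. -/
def puncturedDisc (R : ℝ) : Set Plane := Metric.ball 0 R \ {0}

/-- `u` is a singular solution of `-Δu = f(u)` on the punctured disc of radius `R`: it is
nonnegative and of class `C²` there, solves the equation pointwise, and blows up at the origin.
The values of `u` outside the punctured disc play no role. -/
structure IsSingularSolution (f : ℝ → ℝ) (R : ℝ) (u : Plane → ℝ) : Prop where
  radius_pos : 0 < R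
  contDiffOn : ContDiffOn ℝ 2 u (puncturedDisc R)
  nonneg : ∀ x ∈ puncturedDisc R, 0 ≤ u x
  equation : ∀ x ∈ puncturedDisc R, -(Laplacian.laplacian u x) = f (u x)
  tendsto_atTop : Filter.Tendsto u (𝓝[≠] 0) Filter.atTop

/-- The explicit profile
`(log(1/|x|²) - ((2q+r-1)/q) log log(1/|x|²) + log(4(q-1)/q²))^(1/q)`. -/
noncomputable def singularProfile (q r : ℝ) (x : Plane) : ℝ :=
  (Real.log (1 / ‖x‖ ^ 2) - (2 * q + r - 1) / q * Real.log (Real.log (1 / ‖x‖ ^ 2))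
    + Real.log (4 * (q - 1) / q ^ 2)) ^ (1 / q)

/-- The order `log(-log|x|) / (-log|x|)^(2-1/q)` of the remainder. -/
noncomputable def remainderOrder (q : ℝ) (x : Plane) : ℝ :=
  Real.log (-Real.log ‖x‖) / (-Real.log ‖x‖) ^ (2 - 1 / q)

/-!
In the variable `s = log (1 / ‖x‖ ^ 2)` a radial solution `u x = v s` satisfies
`v'' = -(1 / 4) * exp (-s) * v ^ r * exp (v ^ q)`. Put `p = 1 / q` and let `W` solve
`W + (2 * q + r - 1) / q * log W = s + log (4 * (q - 1) / q ^ 2)`. Then `W ^ p` is a first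
approximation of `v`, and it agrees with the explicit profile up to the required order.

The linearised equation behaves like `η'' + (1 - p) / s * η = 0`, whose WKB modes are
`s ^ (1 / 4) * cos (2 * √((1 - p) * s) + β)`. Estimating the variation of constants integral in
absolute value, without using the oscillation of the modes, costs a factor `s ^ (1 / 2)`. The second
approximation `W ^ p + b * W ^ (p - 2)` with `(1 - p) * b = -(a * p * (3 - 2 * p))`, where
`a = (2 * q + r - 1) / q`, has a residual small enough to afford this loss, and the correction is
`O(s ^ (p - 2))`. The correction is prescribed to decay at `s = ∞`: the substitution `s = ρ ^ (-N)`
turns `s = ∞` into a regular initial time, where the Picard–Lindelöf theorem applies.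
-/

open Filter Asymptotics Set Real

section IntegralCurve

variable {E : Type*} [NormedAddCommGroup E]

theorem continuousOn_Icc_of_norm_le_rpow {g : ℝ → E} {R C κ : ℝ} (hκ : 0 < κ)
    (hcont : ContinuousOn g (Ioc 0 R)) (hbd : ∀ t ∈ Icc 0 R, ‖g t‖ ≤ C * t ^ κ) :
    ContinuousOn g (Icc 0 R) := by
  intro t ht
  rcases ht.1.eq_or_lt with rfl | ht0
  · have hg0 : g 0 = 0 := by simpa [zero_rpow hκ.ne'] using hbd 0 ht
    have hlim : Tendsto (fun t : ℝ => C * t ^ κ) (𝓝[Icc 0 R] 0) (𝓝 0) := by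
      have := ((continuousAt_rpow_const 0 κ (.inr hκ.le)).const_mul C).tendsto
      simp only [zero_rpow hκ.ne', mul_zero] at this
      exact this.mono_left nhdsWithin_le_nhds
    rw [ContinuousWithinAt, hg0]
    exact squeeze_zero_norm' (eventually_mem_nhdsWithin.mono hbd) hlim
  · refine (hcont t ⟨ht0, ht.2⟩).mono_of_mem_nhdsWithin ?_
    filter_upwards [self_mem_nhdsWithin, nhdsWithin_le_nhds (Ioi_mem_nhds ht0)] with s hs hs'
    exact ⟨hs', hs.2⟩

variable [NormedSpace ℝ E]

theorem exists_integralCurve_norm_le_rpow [CompleteSpace E] {f : ℝ → E → E} {R K C κ : ℝ}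
    (hR : 0 < R) (hκ : 0 < κ) (hcont : ∀ x, ContinuousOn (f · x) (Ioc 0 R))
    (hlip : ∀ t ∈ Icc 0 R, ∀ x y, ‖f t x - f t y‖ ≤ K * ‖x - y‖)
    (hbd : ∀ t ∈ Icc 0 R, ∀ x, ‖f t x‖ ≤ C * t ^ κ) :
    ∃ α : ℝ → E, ∀ t ∈ Ioo 0 R,
      HasDerivAt α (f t (α t)) t ∧ ‖α t‖ ≤ C / (κ + 1) * t ^ (κ + 1) := by
  have hC : 0 ≤ C := nonneg_of_mul_nonneg_left
    ((norm_nonneg _).trans (hbd R (right_mem_Icc.2 hR.le) 0)) (rpow_pos_of_pos hR κ)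
  have hPL : IsPicardLindelof f (tmin := 0) (tmax := R) ⟨0, left_mem_Icc.2 hR.le⟩ (0 : E)
      (C * R ^ κ * R).toNNReal 0 (C * R ^ κ).toNNReal K.toNNReal := by
    have hL : 0 ≤ C * R ^ κ := by positivity
    refine ⟨fun t ht => (LipschitzWith.of_dist_le' fun x y => ?_).lipschitzOnWith, fun x _ =>
      continuousOn_Icc_of_norm_le_rpow hκ (hcont x) fun t ht => hbd t ht x, fun t ht x _ => ?_, ?_⟩
    · simpa only [dist_eq_norm] using hlip t ht x y
    · rw [coe_toNNReal _ hL]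
      have ht0 := ht.1
      exact (hbd t ht x).trans (by gcongr; exact ht.2)
    · simp [coe_toNNReal _ hL, coe_toNNReal _ (mul_nonneg hL hR.le), hR.le]
  obtain ⟨α, hα0, hα⟩ := hPL.exists_eq_forall_mem_Icc_hasDerivWithinAt₀
  have hα_norm : ∀ t ∈ Icc 0 R, ‖α t‖ ≤ C / (κ + 1) * t ^ (κ + 1) := by
    refine image_norm_le_of_norm_deriv_right_le_deriv_boundary'
      (f' := fun t => f t (α t)) (B' := fun t => C * t ^ κ)
      (fun t ht => (hα t ht).continuousWithinAt)
      (fun t ht => (hα t (Ico_subset_Icc_self ht)).mono_of_mem_nhdsWithin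
        (Icc_mem_nhdsGE_of_mem ht)) ?_ ?_ ?_ fun t ht => hbd t (Ico_subset_Icc_self ht) _
    · have : α 0 = 0 := hα0
      rw [this, norm_zero, zero_rpow (by linarith), mul_zero]
    · exact continuousOn_const.mul
        (continuousOn_id.rpow_const fun _ _ => .inr (by linarith))
    · intro t _
      refine (((hasDerivAt_rpow_const (.inr (by linarith))).const_mul
        (C / (κ + 1))).congr_deriv ?_).hasDerivWithinAt
      rw [add_sub_cancel_right]
      field_simp
  exact ⟨α, fun t ht => ⟨(hα t (Ioo_subset_Icc_self ht)).hasDerivAt (Icc_mem_nhds ht.1 ht.2),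
    hα_norm t (Ioo_subset_Icc_self ht)⟩⟩

/-- The time-dependent vector field `H` in the inverted time `ρ = s ^ (-N⁻¹)`, in which `s = ∞`
becomes `ρ = 0`. For `N > 0` its value at `ρ = 0` is zero, since `0 ^ (-N - 1) = 0`. -/
noncomputable def invertedTimeField (H : ℝ → E → E) (N ρ : ℝ) (x : E) : E :=
  (-N * ρ ^ (-N - 1)) • H (ρ ^ (-N)) x

theorem hasDerivAt_comp_rpow_of_invertedTimeField {H : ℝ → E → E} {α : ℝ → E} {N s : ℝ}
    (hN : N ≠ 0) (hs : 0 < s)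
    (hα : HasDerivAt α (invertedTimeField H N (s ^ (-N⁻¹)) (α (s ^ (-N⁻¹)))) (s ^ (-N⁻¹))) :
    HasDerivAt (fun s => α (s ^ (-N⁻¹))) (H s (α (s ^ (-N⁻¹)))) s := by
  refine (hα.scomp s (hasDerivAt_rpow_const (.inl hs.ne'))).congr_deriv ?_
  have hinv : (s ^ (-N⁻¹)) ^ (-N) = s := by
    rw [← rpow_mul hs.le, neg_mul_neg, inv_mul_cancel₀ hN, rpow_one]
  have hjac : -N⁻¹ * s ^ (-N⁻¹ - 1) * (-N * (s ^ (-N⁻¹)) ^ (-N - 1)) = 1 := by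
    rw [← rpow_mul hs.le, mul_mul_mul_comm, neg_mul_neg, inv_mul_cancel₀ hN, one_mul,
      ← rpow_add hs, show -N⁻¹ - 1 + -N⁻¹ * (-N - 1) = 0 by field_simp; ring, rpow_zero]
  rw [invertedTimeField, smul_smul, hinv, hjac, one_smul]

theorem norm_inverted_time_smul_le {z : E} {N ρ c e : ℝ} (hN : 0 < N) (hρ : 0 < ρ)
    (hz : ‖z‖ ≤ c * (ρ ^ (-N)) ^ (-e)) :
    ‖(-N * ρ ^ (-N - 1)) • z‖ ≤ N * c * ρ ^ (N * (e - 1) - 1) := by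
  calc ‖(-N * ρ ^ (-N - 1)) • z‖ = N * ρ ^ (-N - 1) * ‖z‖ := by
        rw [norm_smul, norm_mul, norm_neg, norm_of_nonneg hN.le,
          norm_of_nonneg (rpow_nonneg hρ.le _)]
    _ ≤ N * ρ ^ (-N - 1) * (c * (ρ ^ (-N)) ^ (-e)) := by gcongr
    _ = N * c * (ρ ^ (-N - 1) * (ρ ^ (-N)) ^ (-e)) := by ring
    _ = N * c * ρ ^ (N * (e - 1) - 1) := by
        rw [← rpow_mul hρ.le, ← rpow_add hρ]
        ring_nf

theorem invertedTimeField_zero_left (H : ℝ → E → E) {N : ℝ} (hN : 0 < N) :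
    invertedTimeField H N 0 = 0 := by
  ext x
  simp [invertedTimeField, zero_rpow (by linarith : -N - 1 ≠ 0)]

theorem continuousAt_invertedTimeField {H : ℝ → E → E} {N ρ : ℝ} {x : E} (hρ : ρ ≠ 0)
    (hH : ContinuousAt (H · x) (ρ ^ (-N))) :
    ContinuousAt (invertedTimeField H N · x) ρ := by
  have hpow := fun e => continuousAt_rpow_const ρ e (.inl hρ)
  exact (continuousAt_const.mul (hpow _)).smul (hH.comp (f := fun ρ : ℝ => ρ ^ (-N)) (hpow _))

theorem norm_invertedTimeField_le {H : ℝ → E → E} {N C μ ρ : ℝ} {x : E} (hN : 0 < N)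
    (hμ : 1 < N * (μ - 1)) (hρ : 0 ≤ ρ)
    (hbd : 0 < ρ → ‖H (ρ ^ (-N)) x‖ ≤ C * (ρ ^ (-N)) ^ (-μ)) :
    ‖invertedTimeField H N ρ x‖ ≤ N * C * ρ ^ (N * (μ - 1) - 1) := by
  rcases hρ.eq_or_lt with rfl | h0
  · simp [invertedTimeField_zero_left H hN, zero_rpow (by linarith : N * (μ - 1) - 1 ≠ 0)]
  · exact norm_inverted_time_smul_le hN h0 (hbd h0)

theorem norm_invertedTimeField_sub_le {H : ℝ → E → E} {N K ν R ρ : ℝ} {x y : E} (hN : 0 < N)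
    (hν : 1 ≤ N * (ν - 1)) (hρ : ρ ∈ Icc 0 R)
    (hlip : 0 < ρ → ‖H (ρ ^ (-N)) x - H (ρ ^ (-N)) y‖ ≤ K * (ρ ^ (-N)) ^ (-ν) * ‖x - y‖) :
    ‖invertedTimeField H N ρ x - invertedTimeField H N ρ y‖
      ≤ N * |K| * R ^ (N * (ν - 1) - 1) * ‖x - y‖ := by
  rcases hρ.1.eq_or_lt with rfl | h0
  · have hR : 0 ≤ R := hρ.2
    simp only [invertedTimeField_zero_left H hN, Pi.zero_apply, sub_self, norm_zero]
    positivity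
  calc ‖invertedTimeField H N ρ x - invertedTimeField H N ρ y‖
      ≤ N * (K * ‖x - y‖) * ρ ^ (N * (ν - 1) - 1) := by
        rw [invertedTimeField, invertedTimeField, ← smul_sub]
        refine norm_inverted_time_smul_le hN h0 ((hlip h0).trans_eq ?_)
        ring
    _ ≤ N * (|K| * ‖x - y‖) * R ^ (N * (ν - 1) - 1) := by
        gcongr
        exacts [le_abs_self K, hρ.2]
    _ = N * |K| * R ^ (N * (ν - 1) - 1) * ‖x - y‖ := by ring

variable [CompleteSpace E]

theorem exists_integralCurve_isBigO_rpow_atTop {H : ℝ → E → E} {K C ν μ : ℝ}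
    (hν : 1 < ν) (hμ : 1 < μ) (hcont : ∀ᶠ s in atTop, ∀ x, ContinuousAt (H · x) s)
    (hlip : ∀ᶠ s in atTop, ∀ x y, ‖H s x - H s y‖ ≤ K * s ^ (-ν) * ‖x - y‖)
    (hbd : ∀ᶠ s in atTop, ∀ x, ‖H s x‖ ≤ C * s ^ (-μ)) :
    ∃ Y : ℝ → E, (∀ᶠ s in atTop, HasDerivAt Y (H s (Y s)) s) ∧
      Y =O[atTop] fun s => s ^ (1 - μ) := by
  -- In the time `ρ = s ^ (-N⁻¹)`, with `N` large, the point `s = ∞` is a regular initial time.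
  obtain ⟨N, hN, hNν, hNμ⟩ : ∃ N : ℝ, 0 < N ∧ 1 ≤ N * (ν - 1) ∧ 1 < N * (μ - 1) := by
    have := ((tendsto_id.atTop_mul_const (sub_pos.2 hν)).eventually_ge_atTop 1).and
      ((tendsto_id.atTop_mul_const (sub_pos.2 hμ)).eventually_gt_atTop (1 : ℝ))
    exact ((eventually_gt_atTop 0).and this).exists
  obtain ⟨R, hR : 0 < R, hRsub⟩ := mem_nhdsGT_iff_exists_Ioc_subset.1 <|
    (tendsto_rpow_neg_nhdsGT_zero (neg_neg_of_pos hN)).eventually (hcont.and (hlip.and hbd))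
  obtain ⟨α, hα⟩ := exists_integralCurve_norm_le_rpow hR (by linarith)
    (fun x ρ hρ =>
      (continuousAt_invertedTimeField hρ.1.ne' ((hRsub hρ).1 x)).continuousWithinAt)
    (fun ρ hρ x y => norm_invertedTimeField_sub_le hN hNν hρ
      fun h0 => (hRsub ⟨h0, hρ.2⟩).2.1 x y)
    (fun ρ hρ x => norm_invertedTimeField_le hN hNμ hρ.1
      fun h0 => (hRsub ⟨h0, hρ.2⟩).2.2 x)
  have hρ : ∀ᶠ s : ℝ in atTop, s ^ (-N⁻¹) ∈ Ioo 0 R :=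
    ((eventually_gt_atTop 0).mono fun s hs => rpow_pos_of_pos hs _).and
      ((tendsto_rpow_neg_atTop (inv_pos.2 hN)).eventually_lt_const hR)
  refine ⟨fun s => α (s ^ (-N⁻¹)), ?_, IsBigO.of_bound (N * C / (N * (μ - 1) - 1 + 1)) ?_⟩
  · filter_upwards [hρ, eventually_gt_atTop 0] with s hs hs0
    exact hasDerivAt_comp_rpow_of_invertedTimeField hN.ne' hs0 (hα _ hs).1
  · filter_upwards [hρ, eventually_gt_atTop 0] with s hs hs0
    refine (hα _ hs).2.trans_eq ?_
    rw [norm_of_nonneg (rpow_nonneg hs0.le _), ← rpow_mul hs0.le, sub_add_cancel,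
      show -N⁻¹ * (N * (μ - 1)) = 1 - μ by field_simp; ring]

end IntegralCurve

section Oscillator

/-- The WKB approximation `s ^ (1/4) cos (ν √s + β)` to the solutions of `η'' + (ν²/4) η / s = 0`;
it solves exactly the equation with potential `ν²/4 / s + 3/16 / s²`. -/
noncomputable def wkbMode (ν β s : ℝ) : ℝ :=
  s ^ (1 / 4 : ℝ) * cos (ν * s ^ (1 / 2 : ℝ) + β)

/-- The derivative of `wkbMode ν β`. -/
noncomputable def wkbModeDeriv (ν β s : ℝ) : ℝ :=
  1 / 4 * s ^ (-(3 / 4) : ℝ) * cos (ν * s ^ (1 / 2 : ℝ) + β)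
    - ν / 2 * s ^ (-(1 / 4) : ℝ) * sin (ν * s ^ (1 / 2 : ℝ) + β)

theorem hasDerivAt_wkbPhase (ν β : ℝ) {s : ℝ} (hs : 0 < s) :
    HasDerivAt (fun s : ℝ => ν * s ^ (1 / 2 : ℝ) + β) (ν / 2 * s ^ (-(1 / 2) : ℝ)) s := by
  refine (((hasDerivAt_rpow_const (p := 1 / 2) (.inl hs.ne')).const_mul ν).add_const
    β).congr_deriv ?_
  norm_num
  ring

theorem hasDerivAt_wkbMode (ν β : ℝ) {s : ℝ} (hs : 0 < s) :
    HasDerivAt (wkbMode ν β) (wkbModeDeriv ν β s) s := by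
  have hamp : HasDerivAt (fun s : ℝ => s ^ (1 / 4 : ℝ)) (1 / 4 * s ^ (-(3 / 4) : ℝ)) s := by
    refine (hasDerivAt_rpow_const (p := 1 / 4) (.inl hs.ne')).congr_deriv ?_
    norm_num
  refine (hamp.mul (hasDerivAt_wkbPhase ν β hs).cos).congr_deriv ?_
  rw [wkbModeDeriv, show (-(1 / 4) : ℝ) = 1 / 4 + -(1 / 2) by norm_num, rpow_add hs]
  ring

theorem hasDerivAt_wkbModeDeriv (ν β : ℝ) {s : ℝ} (hs : 0 < s) :
    HasDerivAt (wkbModeDeriv ν β) (-(ν ^ 2 / 4 / s + 3 / 16 / s ^ 2) * wkbMode ν β s) s := by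
  have hcos : HasDerivAt (fun s : ℝ => 1 / 4 * s ^ (-(3 / 4) : ℝ))
      (1 / 4 * (-(3 / 4) * s ^ (-(7 / 4) : ℝ))) s := by
    refine ((hasDerivAt_rpow_const (p := -(3 / 4)) (.inl hs.ne')).const_mul (1 / 4)).congr_deriv ?_
    norm_num
  have hsin : HasDerivAt (fun s : ℝ => ν / 2 * s ^ (-(1 / 4) : ℝ))
      (ν / 2 * (-(1 / 4) * s ^ (-(5 / 4) : ℝ))) s := by
    refine ((hasDerivAt_rpow_const (p := -(1 / 4)) (.inl hs.ne')).const_mul (ν / 2)).congr_deriv ?_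
    norm_num
  have hphase := hasDerivAt_wkbPhase ν β hs
  refine ((hcos.mul hphase.cos).sub (hsin.mul hphase.sin)).congr_deriv ?_
  have hs1 : s⁻¹ = s ^ (-1 : ℝ) := (rpow_neg_one s).symm
  have hs2 : (s ^ 2)⁻¹ = s ^ (-2 : ℝ) := by rw [rpow_neg hs.le]; norm_cast
  have e1 : s ^ (-(7 / 4) : ℝ) = (s ^ 2)⁻¹ * s ^ (1 / 4 : ℝ) := by
    rw [hs2, ← rpow_add hs]; norm_num
  have e2 : s ^ (-(3 / 4) : ℝ) * s ^ (-(1 / 2) : ℝ) = s ^ (-(5 / 4) : ℝ) := by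
    rw [← rpow_add hs]; norm_num
  have e3 : s ^ (-(1 / 4) : ℝ) * s ^ (-(1 / 2) : ℝ) = s⁻¹ * s ^ (1 / 4 : ℝ) := by
    rw [hs1, ← rpow_add hs, ← rpow_add hs]; norm_num
  rw [wkbMode, e1, div_eq_mul_inv _ s, div_eq_mul_inv _ (s ^ 2)]
  linear_combination (-(ν / 8) * sin (ν * s ^ (1 / 2 : ℝ) + β)) * e2
    - (ν ^ 2 / 4 * cos (ν * s ^ (1 / 2 : ℝ) + β)) * e3

theorem abs_wkbMode_le (ν β : ℝ) {s : ℝ} (hs : 0 ≤ s) : |wkbMode ν β s| ≤ s ^ (1 / 4 : ℝ) := by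
  have h := rpow_nonneg hs (1 / 4)
  rw [wkbMode, abs_mul, abs_of_nonneg h]
  exact mul_le_of_le_one_right h (abs_cos_le_one _)

theorem wkbMode_wronskian (ν : ℝ) {s : ℝ} (hs : 0 < s) :
    wkbMode ν 0 s * wkbModeDeriv ν (-(π / 2)) s - wkbModeDeriv ν 0 s * wkbMode ν (-(π / 2)) s
      = ν / 2 := by
  have e : s ^ (1 / 4 : ℝ) * s ^ (-(1 / 4) : ℝ) = 1 := by
    rw [← rpow_add hs]; norm_num
  rw [wkbMode, wkbMode, wkbModeDeriv, wkbModeDeriv, ← sub_eq_add_neg,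
    cos_sub_pi_div_two, sin_sub_pi_div_two, add_zero]
  have h := sin_sq_add_cos_sq (ν * s ^ (1 / 2 : ℝ))
  linear_combination (ν / 2) * (sin (ν * s ^ (1 / 2 : ℝ)) ^ 2
    + cos (ν * s ^ (1 / 2 : ℝ)) ^ 2) * e + ν / 2 * h

theorem hasDerivAt_variation_of_constants {e₁ e₂ e₁' e₂' : ℝ → ℝ} {c : ℝ → ℝ × ℝ} {κ w g s : ℝ}
    (hw : w ≠ 0) (he₁ : HasDerivAt e₁ (e₁' s) s) (he₂ : HasDerivAt e₂ (e₂' s) s)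
    (he₁' : HasDerivAt e₁' (κ * e₁ s) s) (he₂' : HasDerivAt e₂' (κ * e₂ s) s)
    (hwronskian : e₁ s * e₂' s - e₁' s * e₂ s = w)
    (hc : HasDerivAt c ((g / w) • (-e₂ s, e₁ s)) s) :
    HasDerivAt (fun s => e₁ s * (c s).1 + e₂ s * (c s).2)
        (e₁' s * (c s).1 + e₂' s * (c s).2) s ∧
      HasDerivAt (fun s => e₁' s * (c s).1 + e₂' s * (c s).2)
        (κ * (e₁ s * (c s).1 + e₂ s * (c s).2) + g) s := by
  have hc₁ : HasDerivAt (fun s => (c s).1) (g / w * -e₂ s) s := hc.fst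
  have hc₂ : HasDerivAt (fun s => (c s).2) (g / w * e₁ s) s := hc.snd
  have hg : g / w * w = g := div_mul_cancel₀ g hw
  exact ⟨((he₁.mul hc₁).add (he₂.mul hc₂)).congr_deriv (by ring),
    ((he₁'.mul hc₁).add (he₂'.mul hc₂)).congr_deriv
      (by linear_combination (g / w) * hwronskian + hg)⟩

/-- The combination of the modes `wkbMode ν 0` and `wkbMode ν (-π/2)` with coefficients `Y`. -/
noncomputable def wkbCombination (ν s : ℝ) (Y : ℝ × ℝ) : ℝ :=
  wkbMode ν 0 s * Y.1 + wkbMode ν (-(π / 2)) s * Y.2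

/-- The system that variation of constants gives for the coefficients of a solution of
`η'' = -(ν²/4 / s + 3/16 / s²) η + g(s, η)` in the two modes of `wkbCombination`, whose Wronskian
is `ν / 2`. -/
noncomputable def wkbSystem (ν : ℝ) (g : ℝ → ℝ → ℝ) (s : ℝ) (Y : ℝ × ℝ) : ℝ × ℝ :=
  (g s (wkbCombination ν s Y) / (ν / 2)) • (-wkbMode ν (-(π / 2)) s, wkbMode ν 0 s)

theorem abs_wkbCombination_le (ν : ℝ) {s : ℝ} (hs : 0 ≤ s) (Y : ℝ × ℝ) :
    |wkbCombination ν s Y| ≤ 2 * s ^ (1 / 4 : ℝ) * ‖Y‖ := by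
  calc |wkbCombination ν s Y|
      ≤ |wkbMode ν 0 s| * |Y.1| + |wkbMode ν (-(π / 2)) s| * |Y.2| := by
        rw [← abs_mul, ← abs_mul]
        exact abs_add_le _ _
    _ ≤ s ^ (1 / 4 : ℝ) * ‖Y‖ + s ^ (1 / 4 : ℝ) * ‖Y‖ := by
        gcongr
        exacts [abs_wkbMode_le _ _ hs, norm_fst_le Y, abs_wkbMode_le _ _ hs, norm_snd_le Y]
    _ = 2 * s ^ (1 / 4 : ℝ) * ‖Y‖ := by ring

theorem wkbCombination_sub (ν s : ℝ) (X Y : ℝ × ℝ) :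
    wkbCombination ν s (X - Y) = wkbCombination ν s X - wkbCombination ν s Y := by
  simp only [wkbCombination, Prod.fst_sub, Prod.snd_sub]
  ring

theorem norm_smul_wkbMode_le {ν s : ℝ} (hν : 0 < ν) (hs : 0 ≤ s) (c : ℝ) :
    ‖(c / (ν / 2)) • (-wkbMode ν (-(π / 2)) s, wkbMode ν 0 s)‖
      ≤ |c| / (ν / 2) * s ^ (1 / 4 : ℝ) := by
  rw [norm_smul, norm_div, norm_of_nonneg (half_pos hν).le, Prod.norm_mk, norm_neg, norm_eq_abs]
  gcongr
  exact max_le (abs_wkbMode_le _ _ hs) (abs_wkbMode_le _ _ hs)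

theorem continuousAt_wkbSystem {ν s : ℝ} {g : ℝ → ℝ → ℝ} (hs : 0 < s)
    (hg : ∀ x, ContinuousAt (Function.uncurry g) (s, x)) (Y : ℝ × ℝ) :
    ContinuousAt (wkbSystem ν g · Y) s := by
  have hmode : ∀ β, ContinuousAt (wkbMode ν β) s := fun β =>
    (hasDerivAt_wkbMode ν β hs).continuousAt
  have harg : ContinuousAt (fun s => (s, wkbCombination ν s Y)) s :=
    continuousAt_id.prodMk (((hmode _).mul_const _).add ((hmode _).mul_const _))
  exact ((ContinuousAt.comp_of_eq (hg _) harg rfl).div_const _).smul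
    ((hmode _).neg.prodMk (hmode _))

theorem norm_wkbSystem_sub_le {ν s K θ : ℝ} {g : ℝ → ℝ → ℝ} (hν : 0 < ν) (hs : 0 < s)
    (hg : ∀ x y, |g s x - g s y| ≤ K * s ^ (-θ) * |x - y|) (X Y : ℝ × ℝ) :
    ‖wkbSystem ν g s X - wkbSystem ν g s Y‖
      ≤ 4 * |K| / ν * s ^ (-(θ - 1 / 2)) * ‖X - Y‖ := by
  calc ‖wkbSystem ν g s X - wkbSystem ν g s Y‖
      ≤ (K * s ^ (-θ) * |wkbCombination ν s (X - Y)|) / (ν / 2) * s ^ (1 / 4 : ℝ) := by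
        rw [wkbSystem, wkbSystem, ← sub_smul, ← sub_div]
        refine (norm_smul_wkbMode_le hν hs.le _).trans ?_
        gcongr
        simpa only [wkbCombination_sub] using hg _ _
    _ ≤ (|K| * s ^ (-θ) * (2 * s ^ (1 / 4 : ℝ) * ‖X - Y‖)) / (ν / 2) * s ^ (1 / 4 : ℝ) := by
        gcongr
        exacts [le_abs_self K, abs_wkbCombination_le ν hs.le _]
    _ = 4 * |K| / ν * (s ^ (-θ) * s ^ (1 / 4 : ℝ) * s ^ (1 / 4 : ℝ)) * ‖X - Y‖ := by
        field_simp
        ring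
    _ = 4 * |K| / ν * s ^ (-(θ - 1 / 2)) * ‖X - Y‖ := by
        rw [← rpow_add hs, ← rpow_add hs]
        ring_nf

theorem norm_wkbSystem_le {ν s C μ : ℝ} {g : ℝ → ℝ → ℝ} (hν : 0 < ν) (hs : 0 < s)
    (hg : ∀ x, |g s x| ≤ C * s ^ (-μ)) (Y : ℝ × ℝ) :
    ‖wkbSystem ν g s Y‖ ≤ 2 * C / ν * s ^ (-(μ - 1 / 4)) := by
  calc ‖wkbSystem ν g s Y‖ ≤ C * s ^ (-μ) / (ν / 2) * s ^ (1 / 4 : ℝ) := by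
        refine (norm_smul_wkbMode_le hν hs.le _).trans ?_
        gcongr
        exact hg _
    _ = 2 * C / ν * (s ^ (-μ) * s ^ (1 / 4 : ℝ)) := by
        field_simp
    _ = 2 * C / ν * s ^ (-(μ - 1 / 4)) := by
        rw [← rpow_add hs]
        ring_nf

theorem exists_oscillator_solution {g : ℝ → ℝ → ℝ} {k K C θ μ : ℝ} (hk : 0 < k) (hθ : 3 / 2 < θ)
    (hμ : 5 / 4 < μ) (hcont : ∀ᶠ s in atTop, ∀ x, ContinuousAt (Function.uncurry g) (s, x))
    (hlip : ∀ᶠ s in atTop, ∀ x y, |g s x - g s y| ≤ K * s ^ (-θ) * |x - y|)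
    (hbd : ∀ᶠ s in atTop, ∀ x, |g s x| ≤ C * s ^ (-μ)) :
    ∃ η η₁ : ℝ → ℝ,
      (∀ᶠ s in atTop, HasDerivAt η (η₁ s) s ∧
        HasDerivAt η₁ (-(k / s + 3 / 16 / s ^ 2) * η s + g s (η s)) s) ∧
      η =O[atTop] fun s => s ^ (3 / 2 - μ) := by
  obtain ⟨ν, hν, hνk⟩ : ∃ ν : ℝ, 0 < ν ∧ ν ^ 2 / 4 = k :=
    ⟨2 * √k, by positivity, by rw [mul_pow, sq_sqrt hk.le]; ring⟩
  have hpos : ∀ᶠ s : ℝ in atTop, 0 < s := eventually_gt_atTop 0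
  obtain ⟨Y, hY, hY_bigO⟩ := exists_integralCurve_isBigO_rpow_atTop
    (H := wkbSystem ν g) (ν := θ - 1 / 2) (μ := μ - 1 / 4) (by linarith) (by linarith)
    (hpos.and hcont |>.mono fun s hs => continuousAt_wkbSystem hs.1 hs.2)
    (hpos.and hlip |>.mono fun s hs => norm_wkbSystem_sub_le hν hs.1 hs.2)
    (hpos.and hbd |>.mono fun s hs => norm_wkbSystem_le hν hs.1 hs.2)
  refine ⟨fun s => wkbCombination ν s (Y s), fun s => wkbModeDeriv ν 0 s * (Y s).1
    + wkbModeDeriv ν (-(π / 2)) s * (Y s).2, ?_, ?_⟩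
  · filter_upwards [hY, hpos] with s hs hs0
    rw [← hνk]
    exact hasDerivAt_variation_of_constants (half_pos hν).ne' (hasDerivAt_wkbMode _ _ hs0)
      (hasDerivAt_wkbMode _ _ hs0) (hasDerivAt_wkbModeDeriv _ _ hs0)
      (hasDerivAt_wkbModeDeriv _ _ hs0) (wkbMode_wronskian _ hs0) hs
  · have hmodes : (fun s => wkbCombination ν s (Y s))
        =O[atTop] fun s => s ^ (1 / 4 : ℝ) * ‖Y s‖ := by
      refine IsBigO.of_bound 2 ?_
      filter_upwards [hpos] with s hs
      rw [norm_of_nonneg (by positivity : 0 ≤ s ^ (1 / 4 : ℝ) * ‖Y s‖), norm_eq_abs, ← mul_assoc]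
      exact abs_wkbCombination_le ν hs.le _
    refine (hmodes.trans ((isBigO_refl _ _).mul hY_bigO.norm_left)).congr' .rfl ?_
    filter_upwards [hpos] with s hs
    rw [← rpow_add hs]
    ring_nf

/-- The nearest point to `x` of `[-d, d]`, for `0 ≤ d`; it truncates a forcing term to the range in
which the latter is under control. -/
def clamp (d x : ℝ) : ℝ := max (min x d) (-d)

theorem abs_clamp_le {d : ℝ} (hd : 0 ≤ d) (x : ℝ) : |clamp d x| ≤ d :=
  abs_le.2 ⟨le_max_right _ _, max_le (min_le_right _ _) (by linarith)⟩

theorem abs_clamp_sub_clamp_le (d x y : ℝ) : |clamp d x - clamp d y| ≤ |x - y| :=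
  calc |clamp d x - clamp d y| ≤ |min x d - min y d| := abs_max_sub_max_le_abs _ _ _
    _ ≤ |x - y| := by simpa using abs_min_sub_min_le_max x d y d

theorem clamp_eq_self {d x : ℝ} (hx : |x| ≤ d) : clamp d x = x := by
  rw [clamp, min_eq_left (abs_le.1 hx).2, max_eq_left (abs_le.1 hx).1]

theorem exists_oscillator_solution_of_local {g : ℝ → ℝ → ℝ} {d : ℝ → ℝ} {k K C θ μ : ℝ}
    (hk : 0 < k) (hK : 0 ≤ K) (hθ : 3 / 2 < θ) (hμ : 5 / 4 < μ)
    (hd : ∀ᶠ s in atTop, ContinuousAt d s ∧ 0 ≤ d s)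
    (hcont : ∀ᶠ s in atTop, ∀ x, |x| ≤ d s → ContinuousAt (Function.uncurry g) (s, x))
    (hlip : ∀ᶠ s in atTop, ∀ x y, |x| ≤ d s → |y| ≤ d s →
      |g s x - g s y| ≤ K * s ^ (-θ) * |x - y|)
    (hbd : ∀ᶠ s in atTop, ∀ x, |x| ≤ d s → |g s x| ≤ C * s ^ (-μ))
    (hsmall : (fun s : ℝ => s ^ (3 / 2 - μ)) =o[atTop] d) :
    ∃ η η₁ : ℝ → ℝ,
      (∀ᶠ s in atTop, |η s| ≤ d s ∧ HasDerivAt η (η₁ s) s ∧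
        HasDerivAt η₁ (-(k / s + 3 / 16 / s ^ 2) * η s + g s (η s)) s) ∧
      η =O[atTop] fun s => s ^ (3 / 2 - μ) := by
  have hcont' : ∀ᶠ s in atTop, ∀ x,
      ContinuousAt (Function.uncurry fun s x => g s (clamp (d s) x)) (s, x) := by
    filter_upwards [hcont, hd] with s hs hds x
    have hd' : ContinuousAt (fun z : ℝ × ℝ => d z.1) (s, x) :=
      ContinuousAt.comp_of_eq hds.1 continuousAt_fst rfl
    have harg : ContinuousAt (fun z : ℝ × ℝ => (z.1, clamp (d z.1) z.2)) (s, x) :=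
      continuousAt_fst.prodMk ((continuousAt_snd.min hd').max hd'.neg)
    exact ContinuousAt.comp_of_eq (hs _ (abs_clamp_le hds.2 x)) harg rfl
  have hlip' : ∀ᶠ s in atTop, ∀ x y,
      |g s (clamp (d s) x) - g s (clamp (d s) y)| ≤ K * s ^ (-θ) * |x - y| := by
    filter_upwards [hlip, hd, eventually_gt_atTop 0] with s hs hds hs0 x y
    refine (hs _ _ (abs_clamp_le hds.2 x) (abs_clamp_le hds.2 y)).trans ?_
    exact mul_le_mul_of_nonneg_left (abs_clamp_sub_clamp_le _ _ _) (by positivity)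
  have hbd' : ∀ᶠ s in atTop, ∀ x, |g s (clamp (d s) x)| ≤ C * s ^ (-μ) := by
    filter_upwards [hbd, hd] with s hs hds x using hs _ (abs_clamp_le hds.2 x)
  obtain ⟨η, η₁, hη, hη_bigO⟩ := exists_oscillator_solution hk hθ hμ hcont' hlip' hbd'
  refine ⟨η, η₁, ?_, hη_bigO⟩
  have hη_le : ∀ᶠ s in atTop, |η s| ≤ d s := by
    filter_upwards [(hη_bigO.trans_isLittleO hsmall).bound one_pos, hd] with s hs hds
    rwa [one_mul, norm_eq_abs, norm_of_nonneg hds.2] at hs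
  filter_upwards [hη, hη_le] with s hs hle
  rw [clamp_eq_self hle] at hs
  exact ⟨hle, hs⟩

end Oscillator

section InverseProfile

theorem exists_rightInverse_atTop_of_deriv_pos {γ γ' : ℝ → ℝ} (hγ : Tendsto γ atTop atTop)
    (hderiv : ∀ᶠ y in atTop, HasDerivAt γ (γ' y) y ∧ 0 < γ' y) :
    ∃ W : ℝ → ℝ, Tendsto W atTop atTop ∧
      ∀ᶠ s in atTop, γ (W s) = s ∧ HasDerivAt W (γ' (W s))⁻¹ s := by
  obtain ⟨a, ha⟩ := eventually_atTop.1 hderiv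
  have hcont : ContinuousOn γ (Ici a) := fun y hy => (ha y hy).1.continuousAt.continuousWithinAt
  have hmono : StrictMonoOn γ (Ici a) := by
    refine strictMonoOn_of_deriv_pos (convex_Ici a) hcont fun y hy => ?_
    obtain ⟨hd, hpos⟩ := ha y (interior_subset hy)
    rwa [hd.deriv]
  have hsurj := intermediate_value_Ici hcont hγ
  set W := Function.invFunOn γ (Ici a)
  have hW_mem {s : ℝ} (hs : γ a ≤ s) : a ≤ W s := Function.invFunOn_mem (hsurj hs)
  have hγW {s : ℝ} (hs : γ a ≤ s) : γ (W s) = s := Function.invFunOn_eq (hsurj hs)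
  have hW_mono : MonotoneOn W (Ici (γ a)) := fun s hs t ht hst => by
    rw [← hmono.le_iff_le (hW_mem hs) (hW_mem ht), hγW hs, hγW ht]
    exact hst
  have himage : Ici a ⊆ W '' Ici (γ a) := fun y hy =>
    ⟨γ y, hmono.monotoneOn self_mem_Ici hy hy, hmono.injOn.leftInvOn_invFunOn hy⟩
  refine ⟨W, ?_, ?_⟩
  · refine tendsto_atTop.2 fun y => ?_
    have hy : a ≤ max a y := le_max_left a y
    filter_upwards [eventually_ge_atTop (γ (max a y))] with s hs
    have has : γ a ≤ s := (hmono.monotoneOn self_mem_Ici hy hy).trans hs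
    exact (le_max_right a y).trans
      ((hmono.le_iff_le hy (hW_mem has)).1 (hs.trans_eq (hγW has).symm))
  · filter_upwards [eventually_gt_atTop (γ a)] with s hs
    have ha_lt : a < W s := by
      rwa [← hmono.lt_iff_lt self_mem_Ici (hW_mem hs.le), hγW hs.le]
    have hcontW : ContinuousAt W s := continuousAt_of_monotoneOn_of_image_mem_nhds hW_mono
      (Ici_mem_nhds hs) (mem_of_superset (Ici_mem_nhds ha_lt) himage)
    obtain ⟨hd, hpos⟩ := ha _ ha_lt.le
    refine ⟨hγW hs.le, hd.of_local_left_inverse hcontW hpos.ne' ?_⟩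
    filter_upwards [lt_mem_nhds hs] with t ht using hγW ht.le

/-- `W` inverts `y ↦ y + a log y - c` near infinity. -/
structure IsInverseProfile (a c : ℝ) (W : ℝ → ℝ) : Prop where
  tendsto_atTop : Tendsto W atTop atTop
  add_log : ∀ᶠ s in atTop, W s + a * log (W s) = s + c
  hasDerivAt : ∀ᶠ s in atTop, HasDerivAt W (W s / (W s + a)) s

theorem exists_isInverseProfile (a c : ℝ) : ∃ W, IsInverseProfile a c W := by
  have hlittle : (fun y => a * log y - c) =o[atTop] (id : ℝ → ℝ) :=
    (isLittleO_log_id_atTop.const_mul_left a).sub (isLittleO_const_id_atTop c)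
  have htendsto : Tendsto (fun y => y + (a * log y - c)) atTop atTop :=
    (IsEquivalent.refl.add_isLittleO hlittle).symm.tendsto_atTop tendsto_id
  have hderiv : ∀ᶠ y in atTop,
      HasDerivAt (fun y => y + (a * log y - c)) (1 + a * y⁻¹) y ∧ 0 < 1 + a * y⁻¹ := by
    filter_upwards [eventually_gt_atTop 0, eventually_gt_atTop (-a)] with y hy hya
    refine ⟨(hasDerivAt_id y).add (((hasDerivAt_log hy.ne').const_mul a).sub_const c), ?_⟩
    have : 0 < (y + a) / y := div_pos (by linarith) hy
    convert this using 1
    field_simp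
  obtain ⟨W, hW, hinv⟩ := exists_rightInverse_atTop_of_deriv_pos htendsto hderiv
  refine ⟨W, hW, hinv.mono fun s hs => by linarith [hs.1], ?_⟩
  filter_upwards [hinv, hW.eventually_gt_atTop 0] with s hs hpos
  convert hs.2 using 1
  field_simp

namespace IsInverseProfile

variable {a c : ℝ} {W : ℝ → ℝ}

theorem isEquivalent_id (hW : IsInverseProfile a c W) : W ~[atTop] fun s => s := by
  have hlittle : (fun s => a * log (W s) - c) =o[atTop] W :=
    ((isLittleO_log_id_atTop.const_mul_left a).sub
      (isLittleO_const_id_atTop c)).comp_tendsto hW.tendsto_atTop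
  refine ((IsEquivalent.refl.add_isLittleO hlittle).congr_left ?_).symm
  filter_upwards [hW.add_log] with s hs
  simp only [Pi.add_apply]
  linarith

theorem isTheta_rpow (hW : IsInverseProfile a c W) (e : ℝ) :
    (fun s => W s ^ e) =Θ[atTop] fun s => s ^ e :=
  hW.isEquivalent_id.isTheta.rpow (hW.tendsto_atTop.eventually_ge_atTop 0) (eventually_ge_atTop 0)

theorem sub_id_isBigO (hW : IsInverseProfile a c W) : (fun s => W s - s) =O[atTop] log := by
  have hlog : (fun s => log (W s)) =O[atTop] log :=
    (hW.isEquivalent_id.log tendsto_id).isBigO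
  have hconst : (fun _ : ℝ => c) =O[atTop] log :=
    (isLittleO_const_left.2 <| Or.inr <| tendsto_norm_atTop_atTop.comp tendsto_log_atTop).isBigO
  refine (hconst.sub (hlog.const_mul_left a)).congr' ?_ .rfl
  filter_upwards [hW.add_log] with s hs
  linarith

end IsInverseProfile

theorem tendsto_div_one_of_isEquivalent {α : Type*} {l : Filter α} {f g : α → ℝ}
    (hfg : f ~[l] g) (hg : ∀ᶠ x in l, 0 < g x) : Tendsto (fun x => f x / g x) l (𝓝 1) :=
  (isEquivalent_iff_tendsto_one (hg.mono fun _ h => h.ne')).1 hfg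

theorem log_sub_log_isBigO {α : Type*} {l : Filter α} {f g : α → ℝ} (hfg : f ~[l] g)
    (hg : ∀ᶠ x in l, 0 < g x) :
    (fun x => log (f x) - log (g x)) =O[l] fun x => (f x - g x) / g x := by
  have hlim := tendsto_div_one_of_isEquivalent hfg hg
  refine ((hasDerivAt_log one_ne_zero).isBigO_sub.comp_tendsto hlim).congr' ?_ ?_
  · filter_upwards [hg, hlim.eventually_ne one_ne_zero] with x hx hne
    rw [Function.comp_apply, log_one, sub_zero, log_div (div_ne_zero_iff.1 hne).1 hx.ne']
  · filter_upwards [hg] with x hx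
    rw [Function.comp_apply, sub_div, div_self hx.ne']

theorem rpow_sub_rpow_isBigO {α : Type*} {l : Filter α} {f g : α → ℝ} (hfg : f ~[l] g)
    (hg : ∀ᶠ x in l, 0 < g x) (p : ℝ) :
    (fun x => f x ^ p - g x ^ p) =O[l] fun x => g x ^ (p - 1) * (f x - g x) := by
  have hlim := tendsto_div_one_of_isEquivalent hfg hg
  have hderiv : HasDerivAt (fun y : ℝ => y ^ p) (p * 1 ^ (p - 1)) 1 :=
    hasDerivAt_rpow_const (Or.inl one_ne_zero)
  refine ((isBigO_refl (fun x => g x ^ p) l).mul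
    (hderiv.isBigO_sub.comp_tendsto hlim)).congr' ?_ ?_
  · filter_upwards [hg, hlim.eventually_const_lt one_pos] with x hx hpos
    have hf : 0 < f x := (div_pos_iff_of_pos_right hx).1 hpos
    rw [Function.comp_apply, one_rpow, div_rpow hf.le hx.le]
    field_simp
  · filter_upwards [hg] with x hx
    rw [Function.comp_apply, rpow_sub_one hx.ne']
    field_simp

theorem IsInverseProfile.rpow_sub_explicit_rpow_isBigO {a c : ℝ} {W : ℝ → ℝ}
    (hW : IsInverseProfile a c W) (p : ℝ) :
    (fun s => W s ^ p - (s - a * log s + c) ^ p) =O[atTop] fun s => log s / s ^ (2 - p) := by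
  have hexplicit : (fun s => s - a * log s + c) ~[atTop] fun s : ℝ => s := by
    have hlittle : (fun s => -(a * log s) + c) =o[atTop] (fun s : ℝ => s) :=
      (isLittleO_log_id_atTop.const_mul_left a).neg_left.add (isLittleO_const_id_atTop c)
    refine (IsEquivalent.refl.add_isLittleO hlittle).congr_left (.of_forall fun s => ?_)
    simp only [Pi.add_apply]
    ring
  have hdiff : (fun s => W s - (s - a * log s + c)) =O[atTop] fun s => log s / s := by
    have hlog := log_sub_log_isBigO hW.isEquivalent_id (eventually_gt_atTop 0)
    have hquot : (fun s => (W s - s) / s) =O[atTop] fun s => log s / s := by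
      simpa only [div_eq_mul_inv] using hW.sub_id_isBigO.mul (isBigO_refl _ _)
    refine ((hlog.trans hquot).const_mul_left (-a)).congr' ?_ .rfl
    filter_upwards [hW.add_log] with s hs
    linarith
  have hpow : (fun s => (s - a * log s + c) ^ (p - 1)) =O[atTop] fun s => s ^ (p - 1) :=
    (hexplicit.isTheta.rpow
      ((hexplicit.symm.tendsto_atTop tendsto_id).eventually_ge_atTop 0)
      (eventually_ge_atTop 0)).isBigO
  have hpos : ∀ᶠ s in atTop, 0 < s - a * log s + c :=
    (hexplicit.symm.tendsto_atTop tendsto_id).eventually_gt_atTop 0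
  refine ((rpow_sub_rpow_isBigO (hW.isEquivalent_id.trans hexplicit.symm) hpos p).trans
    (hpow.mul hdiff)).congr' .rfl ?_
  filter_upwards [eventually_gt_atTop 0] with s hs
  rw [rpow_sub_one hs.ne', rpow_sub hs, rpow_two]
  field_simp

end InverseProfile

section RescaledNonlinearity

/-- The nonlinearity `v ^ r * exp (v ^ q)` at `v = ε ^ (-1 / q) * (1 + ε * ξ)`, divided by its value
at `ξ = 0`. -/
noncomputable def rescaledNonlinearity (q r ε ξ : ℝ) : ℝ :=
  (1 + ε * ξ) ^ r * exp (((1 + ε * ξ) ^ q - 1) / ε)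

/-- The logarithmic derivative of `rescaledNonlinearity q r ε`. -/
noncomputable def rescaledNonlinearityLogDeriv (q r ε ξ : ℝ) : ℝ :=
  r * ε * (1 + ε * ξ)⁻¹ + q * (1 + ε * ξ) ^ (q - 1)

theorem rescaledNonlinearity_zero_right (q r ε : ℝ) : rescaledNonlinearity q r ε 0 = 1 := by
  simp [rescaledNonlinearity]

theorem hasDerivAt_rescaledNonlinearity (q r : ℝ) {ε ξ : ℝ} (hε : ε ≠ 0) (hξ : 0 < 1 + ε * ξ) :
    HasDerivAt (rescaledNonlinearity q r ε)
      (rescaledNonlinearity q r ε ξ * rescaledNonlinearityLogDeriv q r ε ξ) ξ := by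
  have hbase : HasDerivAt (fun ξ => 1 + ε * ξ) ε ξ := by
    simpa using ((hasDerivAt_id ξ).const_mul ε).const_add 1
  have hpow := hbase.rpow_const (p := r) (Or.inl hξ.ne')
  have hexp := (((hbase.rpow_const (p := q) (Or.inl hξ.ne')).sub_const 1).div_const ε).exp
  refine (hpow.mul hexp).congr_deriv ?_
  rw [rescaledNonlinearityLogDeriv, rescaledNonlinearity, rpow_sub_one hξ.ne' r]
  field_simp

theorem one_add_rpow_sub_one_isBigO {α : Type*} {l : Filter α} {u : α → ℝ}
    (hu : Tendsto u l (𝓝 0)) (e : ℝ) : (fun x => (1 + u x) ^ e - 1) =O[l] u := by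
  have hlim : Tendsto (fun x => 1 + u x) l (𝓝 1) := by simpa using hu.const_add 1
  have hderiv : HasDerivAt (fun y : ℝ => y ^ e) (e * 1 ^ (e - 1)) 1 :=
    hasDerivAt_rpow_const (Or.inl one_ne_zero)
  refine (hderiv.isBigO_sub.comp_tendsto hlim).congr (fun x => ?_) fun x => ?_
  · simp only [Function.comp_apply, one_rpow]
  · simp only [Function.comp_apply, add_sub_cancel_left]

section Limit

variable {α : Type*} {l : Filter α} {ε ξ : α → ℝ}

theorem rescaledNonlinearity_sub_one_isBigO (q r : ℝ) (hε : Tendsto ε l (𝓝[≠] 0))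
    (hξ : Tendsto ξ l (𝓝 0)) :
    (fun x => rescaledNonlinearity q r (ε x) (ξ x) - 1) =O[l] ξ := by
  obtain ⟨hε₀, hε_ne⟩ := tendsto_nhdsWithin_iff.1 hε
  have hεξ : Tendsto (fun x => ε x * ξ x) l (𝓝 0) := by simpa using hε₀.mul hξ
  have hεξ_bigO : (fun x => ε x * ξ x) =O[l] ξ := by
    simpa using (hε₀.isBigO_one ℝ).mul (isBigO_refl ξ l)
  have hexponent : (fun x => ((1 + ε x * ξ x) ^ q - 1) / ε x) =O[l] ξ := by
    refine ((isBigO_refl (fun x => (ε x)⁻¹) l).mul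
      (one_add_rpow_sub_one_isBigO hεξ q)).congr' ?_ ?_
    · exact .of_forall fun x => inv_mul_eq_div _ _
    · filter_upwards [hε_ne] with x hx using inv_mul_cancel_left₀ hx _
  have hexp : (fun x => exp (((1 + ε x * ξ x) ^ q - 1) / ε x) - 1) =O[l] ξ := by
    have h := (hasDerivAt_exp 0).isBigO_sub.comp_tendsto (hexponent.trans_tendsto hξ)
    simp only [exp_zero, sub_zero] at h
    exact h.trans hexponent
  have hpow := (one_add_rpow_sub_one_isBigO hεξ r).trans hεξ_bigO
  have hexp_one : (fun x => exp (((1 + ε x * ξ x) ^ q - 1) / ε x)) =O[l] fun _ => (1 : ℝ) :=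
    ((continuous_exp.tendsto 0).comp (hexponent.trans_tendsto hξ)).isBigO_one ℝ
  refine ((hpow.mul hexp_one).add (hexp.congr_right fun x => (mul_one (ξ x)).symm)).congr
    (fun x => ?_) fun x => mul_one (ξ x)
  rw [rescaledNonlinearity]
  ring

theorem rescaledNonlinearityLogDeriv_sub_isBigO (q r : ℝ) (hε : Tendsto ε l (𝓝 0))
    (hξ : Tendsto ξ l (𝓝 0)) :
    (fun x => rescaledNonlinearityLogDeriv q r (ε x) (ξ x) - q) =O[l] ε := by
  have hεξ : Tendsto (fun x => ε x * ξ x) l (𝓝 0) := by simpa using hε.mul hξ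
  have hεξ_bigO : (fun x => ε x * ξ x) =O[l] ε := by
    simpa using (isBigO_refl ε l).mul (hξ.isBigO_one ℝ)
  have hinv : (fun x => (1 + ε x * ξ x)⁻¹) =O[l] fun _ => (1 : ℝ) :=
    ((hεξ.const_add 1).inv₀ (by norm_num)).isBigO_one ℝ
  have hpow := (one_add_rpow_sub_one_isBigO hεξ (q - 1)).trans hεξ_bigO
  refine ((((isBigO_refl ε l).mul hinv).const_mul_left r).congr_right
    (fun x => mul_one (ε x)) |>.add (hpow.const_mul_left q)).congr_left fun x => ?_
  rw [rescaledNonlinearityLogDeriv]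
  ring

theorem deriv_rescaledNonlinearity_sub_isBigO (q r : ℝ) (hε : Tendsto ε l (𝓝[≠] 0))
    (hξ : Tendsto ξ l (𝓝 0)) :
    (fun x => rescaledNonlinearity q r (ε x) (ξ x) *
        rescaledNonlinearityLogDeriv q r (ε x) (ξ x) - q) =O[l] fun x => |ε x| + |ξ x| := by
  have hε_le : ε =O[l] fun x => |ε x| + |ξ x| := .of_norm_le fun x => by
    rw [norm_eq_abs]
    linarith [abs_nonneg (ξ x)]
  have hξ_le : ξ =O[l] fun x => |ε x| + |ξ x| := .of_norm_le fun x => by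
    rw [norm_eq_abs]
    linarith [abs_nonneg (ε x)]
  have hG := rescaledNonlinearity_sub_one_isBigO q r hε hξ
  have hL := rescaledNonlinearityLogDeriv_sub_isBigO q r (tendsto_nhdsWithin_iff.1 hε).1 hξ
  have hL_one : (fun x => rescaledNonlinearityLogDeriv q r (ε x) (ξ x)) =O[l]
      fun _ => (1 : ℝ) := by
    have hlim := (hL.trans_tendsto (tendsto_nhdsWithin_iff.1 hε).1).add_const q
    simp only [sub_add_cancel] at hlim
    exact hlim.isBigO_one ℝ
  refine (((hG.mul hL_one).congr_right fun x => mul_one (ξ x)).trans hξ_le |>.add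
    (hL.trans hε_le)).congr_left fun x => ?_
  ring

end Limit

theorem exists_abs_rescaledNonlinearity_sub_sub_le (q r : ℝ) :
    ∃ C, ∀ᶠ t in 𝓝[>] 0, ∀ ε, 0 < ε → ε ≤ t → ∀ x y, |x| ≤ t → |y| ≤ t →
      |rescaledNonlinearity q r ε x - rescaledNonlinearity q r ε y - q * (x - y)|
        ≤ C * t * |x - y| := by
  have hbigO := deriv_rescaledNonlinearity_sub_isBigO q r
    (l := 𝓝[>] (0 : ℝ) ×ˢ 𝓝 (0 : ℝ)) (ε := Prod.fst) (ξ := Prod.snd)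
    (tendsto_fst.mono_right (nhdsWithin_mono _ fun _ h => ne_of_gt h)) tendsto_snd
  obtain ⟨C, hC, hbound⟩ := hbigO.exists_nonneg
  obtain ⟨P, hP, Q, hQ, hPQ⟩ := eventually_prod_iff.1 hbound.bound
  obtain ⟨δ₁, hδ₁, hP⟩ := mem_nhdsGT_iff_exists_Ioo_subset.1 hP
  obtain ⟨δ₂, hδ₂, hQ⟩ := Metric.eventually_nhds_iff.1 hQ
  refine ⟨2 * C, ?_⟩
  filter_upwards [Ioo_mem_nhdsGT (lt_min hδ₁ (lt_min hδ₂ one_pos))] with t ht ε hε hεt x y hx hy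
  simp only [mem_Ioo, lt_min_iff] at ht
  have hderiv : ∀ ξ ∈ Icc (-t) t, HasDerivWithinAt (fun ξ => rescaledNonlinearity q r ε ξ - q * ξ)
      (rescaledNonlinearity q r ε ξ * rescaledNonlinearityLogDeriv q r ε ξ - q)
      (Icc (-t) t) ξ := fun ξ hξ => by
    have hpos : 0 < 1 + ε * ξ := by nlinarith [hξ.1]
    exact ((hasDerivAt_rescaledNonlinearity q r hε.ne' hpos).sub
      (hasDerivAt_const_mul q)).hasDerivWithinAt
  have hderiv_le : ∀ ξ ∈ Icc (-t) t,
      ‖rescaledNonlinearity q r ε ξ * rescaledNonlinearityLogDeriv q r ε ξ - q‖ ≤ 2 * C * t :=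
    fun ξ hξ => by
    have hξt : |ξ| ≤ t := abs_le.2 hξ
    have h := hPQ (hP ⟨hε, hεt.trans_lt ht.2.1⟩)
      (hQ (by rw [dist_zero_right, norm_eq_abs]; exact hξt.trans_lt ht.2.2.1))
    rw [norm_of_nonneg (by positivity : 0 ≤ |ε| + |ξ|), abs_of_pos hε] at h
    exact h.trans (by nlinarith)
  have hmvt := (convex_Icc (-t) t).norm_image_sub_le_of_norm_hasDerivWithin_le hderiv hderiv_le
    (abs_le.1 hy) (abs_le.1 hx)
  simp only [norm_eq_abs] at hmvt
  convert hmvt using 2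
  ring

theorem continuousAt_rescaledNonlinearity {X : Type*} [TopologicalSpace X] (q r : ℝ)
    {ε ξ : X → ℝ} {x : X} (hε : ContinuousAt ε x) (hξ : ContinuousAt ξ x) (hε₀ : ε x ≠ 0)
    (hpos : 0 < 1 + ε x * ξ x) :
    ContinuousAt (fun x => rescaledNonlinearity q r (ε x) (ξ x)) x := by
  have hbase : ContinuousAt (fun x => 1 + ε x * ξ x) x := continuousAt_const.add (hε.mul hξ)
  exact (hbase.rpow_const (Or.inl hpos.ne')).mul
    (((hbase.rpow_const (Or.inl hpos.ne')).sub continuousAt_const).div hε hε₀).rexp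

theorem exp_neg_mul_nonlinearity_eq {q r s y ξ : ℝ} (hq : 1 < q) (hy : 0 < y)
    (hys : y + (2 * q + r - 1) / q * log y = s + log (4 * (q - 1) / q ^ 2))
    (hξ : 0 < 1 + y⁻¹ * ξ) :
    1 / 4 * exp (-s) * ((y ^ (1 / q) * (1 + y⁻¹ * ξ)) ^ r *
      exp ((y ^ (1 / q) * (1 + y⁻¹ * ξ)) ^ q)) =
    1 / q * (1 - 1 / q) * y ^ (1 / q - 1) / y * rescaledNonlinearity q r y⁻¹ ξ := by
  have hq₀ : 0 < q := by linarith
  have hyp : 0 < y ^ (1 / q) := rpow_pos_of_pos hy _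
  have hpow_q : (y ^ (1 / q) * (1 + y⁻¹ * ξ)) ^ q = ((1 + y⁻¹ * ξ) ^ q - 1) / y⁻¹ + y := by
    rw [mul_rpow hyp.le hξ.le, ← rpow_mul hy.le, one_div, inv_mul_cancel₀ hq₀.ne', rpow_one]
    field_simp
    ring
  have hpow_r : (y ^ (1 / q) * (1 + y⁻¹ * ξ)) ^ r = y ^ (r / q) * (1 + y⁻¹ * ξ) ^ r := by
    rw [mul_rpow hyp.le hξ.le, ← rpow_mul hy.le, one_div_mul_eq_div]
  have hexp : exp (-s) = 4 * (q - 1) / q ^ 2 * exp (-y) * y ^ (-((2 * q + r - 1) / q)) := by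
    have hpos : 0 < 4 * (q - 1) / q ^ 2 := by
      have : 0 < q - 1 := by linarith
      positivity
    rw [rpow_def_of_pos hy]
    nth_rw 1 [← exp_log hpos]
    rw [← exp_add, ← exp_add]
    congr 1
    linarith
  have hpow_y : y ^ (1 / q - 1) / y = y ^ (-((2 * q + r - 1) / q)) * y ^ (r / q) := by
    rw [← rpow_add hy, ← rpow_sub_one hy.ne']
    congr 1
    field_simp
    ring
  rw [hpow_q, hpow_r, hexp, exp_add, mul_div_assoc _ (y ^ (1 / q - 1)) y, hpow_y,
    rescaledNonlinearity, exp_neg]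
  have := exp_pos y
  field_simp

end RescaledNonlinearity

section CorrectionEquation

/-- The defect, divided by `W ^ (p - 1)`, of the approximate solution `W ^ p + b * W ^ (p - 2)` at
`W = y`, when the rescaled nonlinearity is replaced by its linearisation. -/
noncomputable def approxResidual (p a b y : ℝ) : ℝ :=
  p * y * (p / (y + a) ^ 2 - y / (y + a) ^ 3)
    + b * (p - 2) / y * ((p - 2) / (y + a) ^ 2 - y / (y + a) ^ 3)
    + p * (1 - p) / y + (1 - p) * b / y ^ 2

theorem approxResidual_isBigO {p a b : ℝ} (hb : (1 - p) * b = -(a * p * (3 - 2 * p))) :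
    approxResidual p a b =O[atTop] fun y => y ^ (-3 : ℝ) := by
  set φ : ℝ → ℝ := fun x =>
    p * a ^ 2 * ((1 - p) * (3 + a * x) - (3 - 2 * p) * (3 + 3 * a * x + a ^ 2 * x ^ 2)) /
      (1 + a * x) ^ 3 + b * (p - 2) * ((p - 2) / (1 + a * x) ^ 2 - 1 / (1 + a * x) ^ 3)
  have hφ : ContinuousAt φ 0 := by
    have h2 : (1 + a * 0) ^ 2 ≠ 0 := by norm_num
    have h3 : (1 + a * 0) ^ 3 ≠ 0 := by norm_num
    fun_prop (disch := assumption)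
  have hφ_bigO : (fun y => φ y⁻¹) =O[atTop] fun _ => (1 : ℝ) :=
    (hφ.tendsto.comp tendsto_inv_atTop_zero).isBigO_one ℝ
  refine (hφ_bigO.mul (isBigO_refl (fun y : ℝ => y ^ (-3 : ℝ)) atTop)).congr' ?_
    (.of_forall fun y => one_mul _)
  filter_upwards [eventually_gt_atTop 0, eventually_gt_atTop (-a)] with y hy hya
  have hya_ne : y + a ≠ 0 := by linarith
  have hbase : 1 + a * y⁻¹ = (y + a) / y := by field_simp
  have hpow : y ^ (-3 : ℝ) = (y ^ 3)⁻¹ := by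
    rw [rpow_neg hy.le]
    norm_cast
  simp only [φ, approxResidual, hbase, hb, hpow]
  field_simp
  ring

/-- What is left of the rescaled nonlinearity, at `ε = 1 / y` and `b / y + ξ`, after its
linearisation is removed. -/
noncomputable def nonlinearRemainder (q r b y ξ : ℝ) : ℝ :=
  rescaledNonlinearity q r y⁻¹ (b / y + ξ) - 1 - q * (b / y + ξ)

/-- The difference between the coefficient `(1 - p) / W` of the linearised equation, at `W = y`, and
the coefficient for which the WKB modes are exact solutions. -/
noncomputable def coefficientError (p y s : ℝ) : ℝ :=
  (1 - p) / y - (1 - p) / s - 3 / 16 / s ^ 2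

/-- The correction `W ^ (p - 1) * ξ` to `W ^ p + b * W ^ (p - 2)` is driven, beyond the exactly
solvable linear part of its equation, by `W ^ (p - 1) * correctionForcing q r p a b (W s) s ξ`. -/
noncomputable def correctionForcing (q r p a b y s ξ : ℝ) : ℝ :=
  -approxResidual p a b y - p * (1 - p) / y * nonlinearRemainder q r b y ξ
    - coefficientError p y s * ξ

theorem continuousAt_correctionForcing {X : Type*} [TopologicalSpace X] (q r p a b : ℝ)
    {y s ξ : X → ℝ} {x : X} (hy : ContinuousAt y x) (hs : ContinuousAt s x)
    (hξ : ContinuousAt ξ x) (hy₀ : y x ≠ 0) (hya : y x + a ≠ 0) (hs₀ : s x ≠ 0)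
    (hpos : 0 < 1 + (y x)⁻¹ * (b / y x + ξ x)) :
    ContinuousAt (fun x => correctionForcing q r p a b (y x) (s x) (ξ x)) x := by
  have harg : ContinuousAt (fun x => b / y x + ξ x) x := by fun_prop (disch := assumption)
  have hremainder : ContinuousAt (fun x => nonlinearRemainder q r b (y x) (ξ x)) x :=
    ((continuousAt_rescaledNonlinearity q r (hy.inv₀ hy₀) harg (inv_ne_zero hy₀)
      hpos).sub continuousAt_const).sub (harg.const_mul q)
  unfold correctionForcing approxResidual coefficientError
  fun_prop (disch := simp [hs₀, hy₀, hya])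

theorem rpow_isLittleO_rpow_atTop {e f : ℝ} (h : e < f) :
    (fun s : ℝ => s ^ e) =o[atTop] fun s => s ^ f := by
  refine (isLittleO_iff_tendsto' ?_).2 ?_
  · filter_upwards [eventually_gt_atTop 0] with s hs hzero
    exact absurd hzero (rpow_pos_of_pos hs f).ne'
  · refine (tendsto_rpow_neg_atTop (sub_pos.2 h)).congr' ?_
    filter_upwards [eventually_gt_atTop 0] with s hs
    rw [neg_sub, rpow_sub hs]

namespace IsInverseProfile

variable {a c : ℝ} {W : ℝ → ℝ}

theorem inv_isBigO (hW : IsInverseProfile a c W) :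
    (fun s => (W s)⁻¹) =O[atTop] fun s => s ^ (-1 : ℝ) := by
  simpa only [rpow_neg_one] using (hW.isTheta_rpow (-1)).isBigO

theorem eventually_abs_div_le (hW : IsInverseProfile a c W) (b : ℝ) {e : ℝ} (he : e < 1) :
    ∀ᶠ s in atTop, |b / W s| ≤ s ^ (-e) := by
  have hlittle : (fun s => b / W s) =o[atTop] fun s => s ^ (-e) := by
    simp only [div_eq_mul_inv]
    exact (hW.inv_isBigO.const_mul_left b).trans_isLittleO
      (rpow_isLittleO_rpow_atTop (by linarith))
  filter_upwards [hlittle.bound one_pos, eventually_ge_atTop 0] with s hs hs₀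
  rwa [one_mul, norm_of_nonneg (rpow_nonneg hs₀ _)] at hs

theorem coefficientError_isBigO (hW : IsInverseProfile a c W) (p : ℝ) :
    (fun s => coefficientError p (W s) s) =O[atTop] fun s => s ^ (-(7 / 4) : ℝ) := by
  have hlog : (fun s => s - W s) =O[atTop] fun s => s ^ (1 / 4 : ℝ) :=
    (hW.sub_id_isBigO.symm.trans (isLittleO_log_rpow_atTop (by norm_num)).isBigO)
  have hdiff : (fun s => (1 - p) * (s - W s) * (W s)⁻¹ * s ^ (-1 : ℝ)) =O[atTop]
      fun s => s ^ (-(7 / 4) : ℝ) := by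
    refine (((hlog.const_mul_left (1 - p)).mul hW.inv_isBigO).mul
      (isBigO_refl (fun s : ℝ => s ^ (-1 : ℝ)) atTop)).congr' .rfl ?_
    filter_upwards [eventually_gt_atTop 0] with s hs
    rw [← rpow_add hs, ← rpow_add hs]
    norm_num
  have hsq : (fun s : ℝ => 3 / 16 * s ^ (-2 : ℝ)) =O[atTop] fun s => s ^ (-(7 / 4) : ℝ) :=
    (rpow_isLittleO_rpow_atTop (by norm_num)).isBigO.const_mul_left _
  refine (hdiff.sub hsq).congr' ?_ .rfl
  filter_upwards [eventually_gt_atTop 0, hW.tendsto_atTop.eventually_gt_atTop 0] with s hs hWs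
  rw [coefficientError, rpow_neg_one, rpow_neg hs.le, rpow_two]
  field_simp

theorem exists_abs_nonlinearRemainder_sub_le (hW : IsInverseProfile a c W) (q r b : ℝ) :
    ∃ C, ∀ᶠ s in atTop, ∀ ξ ζ, |ξ| ≤ s ^ (-(3 / 4) : ℝ) → |ζ| ≤ s ^ (-(3 / 4) : ℝ) →
      |nonlinearRemainder q r b (W s) ξ - nonlinearRemainder q r b (W s) ζ|
        ≤ C * s ^ (-(3 / 4) : ℝ) * |ξ - ζ| := by
  obtain ⟨C, hlip⟩ := exists_abs_rescaledNonlinearity_sub_sub_le q r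
  have htwo : Tendsto (fun s : ℝ => 2 * s ^ (-(3 / 4) : ℝ)) atTop (𝓝[>] 0) := by
    refine tendsto_nhdsWithin_iff.2 ⟨?_, ?_⟩
    · simpa using (tendsto_rpow_neg_atTop (y := 3 / 4) (by norm_num)).const_mul 2
    · filter_upwards [eventually_gt_atTop 0] with s hs
      exact mul_pos two_pos (rpow_pos_of_pos hs _)
  refine ⟨2 * C, ?_⟩
  filter_upwards [htwo.eventually hlip, hW.eventually_abs_div_le 1 (e := 3 / 4) (by norm_num),
    hW.eventually_abs_div_le b (e := 3 / 4) (by norm_num), hW.tendsto_atTop.eventually_gt_atTop 0]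
    with s hs hinv hb hWs ξ ζ hξ hζ
  have hinv' : (W s)⁻¹ ≤ 2 * s ^ (-(3 / 4) : ℝ) := by
    rw [one_div, abs_of_pos (inv_pos.2 hWs)] at hinv
    linarith [inv_pos.2 hWs]
  have habs {x : ℝ} (hx : |x| ≤ s ^ (-(3 / 4) : ℝ)) : |b / W s + x| ≤ 2 * s ^ (-(3 / 4) : ℝ) :=
    (abs_add_le _ _).trans (by linarith)
  convert hs _ (inv_pos.2 hWs) hinv' _ _ (habs hξ) (habs hζ) using 1
  · simp only [nonlinearRemainder]
    ring_nf
  · ring_nf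

theorem nonlinearRemainder_zero_isBigO (hW : IsInverseProfile a c W) (q r b : ℝ) :
    (fun s => nonlinearRemainder q r b (W s) 0) =O[atTop] fun s => s ^ (-(7 / 4) : ℝ) := by
  obtain ⟨C, hlip⟩ := hW.exists_abs_nonlinearRemainder_sub_le q r b
  have hle : (fun s => nonlinearRemainder q r b (W s) 0) =O[atTop]
      fun s => s ^ (-(3 / 4) : ℝ) * (b / W s) := by
    refine .of_bound C ?_
    filter_upwards [hlip, hW.eventually_abs_div_le b (e := 3 / 4) (by norm_num),
      eventually_ge_atTop 0] with s hs hb hs₀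
    have hpow : 0 ≤ s ^ (-(3 / 4) : ℝ) := rpow_nonneg hs₀ _
    -- The remainder vanishes at `ξ = -b / W`.
    have h := hs 0 (-(b / W s)) (by rwa [abs_zero]) (by rwa [abs_neg])
    have hvanish : nonlinearRemainder q r b (W s) (-(b / W s)) = 0 := by
      simp [nonlinearRemainder, rescaledNonlinearity_zero_right]
    rwa [hvanish, sub_zero, sub_neg_eq_add, zero_add, mul_assoc, ← norm_eq_abs,
      ← norm_eq_abs (b / W s), ← norm_of_nonneg hpow, ← norm_mul] at h
  have hdiv : (fun s => b / W s) =O[atTop] fun s => s ^ (-1 : ℝ) := by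
    simpa only [div_eq_mul_inv] using hW.inv_isBigO.const_mul_left b
  refine hle.trans (((isBigO_refl (fun s : ℝ => s ^ (-(3 / 4) : ℝ)) atTop).mul hdiv).congr' .rfl ?_)
  filter_upwards [eventually_gt_atTop 0] with s hs
  rw [← rpow_add hs]
  norm_num

theorem correctionForcing_zero_isBigO (hW : IsInverseProfile a c W) (q r : ℝ) {p b : ℝ}
    (hb : (1 - p) * b = -(a * p * (3 - 2 * p))) :
    (fun s => correctionForcing q r p a b (W s) s 0) =O[atTop] fun s => s ^ (-(5 / 2) : ℝ) := by
  have hres : (fun s => approxResidual p a b (W s)) =O[atTop] fun s => s ^ (-(5 / 2) : ℝ) :=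
    ((approxResidual_isBigO hb).comp_tendsto hW.tendsto_atTop).trans
      ((hW.isTheta_rpow (-3)).isBigO.trans (rpow_isLittleO_rpow_atTop (by norm_num)).isBigO)
  have hnonlin : (fun s => p * (1 - p) / W s * nonlinearRemainder q r b (W s) 0) =O[atTop]
      fun s => s ^ (-(5 / 2) : ℝ) := by
    have h := (hW.inv_isBigO.const_mul_left (p * (1 - p))).mul
      (hW.nonlinearRemainder_zero_isBigO q r b)
    simp only [← div_eq_mul_inv] at h
    refine h.trans
      ((rpow_isLittleO_rpow_atTop (e := -(11 / 4)) (by norm_num)).isBigO.congr' ?_ .rfl)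
    filter_upwards [eventually_gt_atTop 0] with s hs
    rw [← rpow_add hs]
    norm_num
  refine (hres.neg_left.sub hnonlin).congr_left fun s => ?_
  simp only [correctionForcing, mul_zero, sub_zero]

theorem exists_abs_correctionForcing_sub_le (hW : IsInverseProfile a c W) (q r p b : ℝ) :
    ∃ K, 0 ≤ K ∧ ∀ᶠ s in atTop, ∀ ξ ζ, |ξ| ≤ s ^ (-(3 / 4) : ℝ) → |ζ| ≤ s ^ (-(3 / 4) : ℝ) →
      |correctionForcing q r p a b (W s) s ξ - correctionForcing q r p a b (W s) s ζ|
        ≤ K * s ^ (-(7 / 4) : ℝ) * |ξ - ζ| := by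
  obtain ⟨C, hlip⟩ := hW.exists_abs_nonlinearRemainder_sub_le q r b
  have hlinear : (fun s => |p * (1 - p) / W s| * (C * s ^ (-(3 / 4) : ℝ))) =O[atTop]
      fun s => s ^ (-(7 / 4) : ℝ) := by
    simp only [div_eq_mul_inv]
    refine ((hW.inv_isBigO.const_mul_left (p * (1 - p))).abs_left.mul
      ((isBigO_refl (fun s : ℝ => s ^ (-(3 / 4) : ℝ)) atTop).const_mul_left C)).congr' .rfl ?_
    filter_upwards [eventually_gt_atTop 0] with s hs
    rw [← rpow_add hs]
    norm_num
  obtain ⟨K, hK, hbound⟩ :=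
    (hlinear.add (hW.coefficientError_isBigO p).abs_left).exists_nonneg
  refine ⟨K, hK, ?_⟩
  filter_upwards [hlip, hbound.bound, eventually_ge_atTop 0] with s hs hbound hs₀ ξ ζ hξ hζ
  rw [norm_of_nonneg (rpow_nonneg hs₀ _)] at hbound
  calc |correctionForcing q r p a b (W s) s ξ - correctionForcing q r p a b (W s) s ζ|
      = |p * (1 - p) / W s * (nonlinearRemainder q r b (W s) ξ - nonlinearRemainder q r b (W s) ζ)
          + coefficientError p (W s) s * (ξ - ζ)| := by
        rw [← abs_neg]
        simp only [correctionForcing]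
        ring_nf
    _ ≤ |p * (1 - p) / W s| * (C * s ^ (-(3 / 4) : ℝ) * |ξ - ζ|)
          + |coefficientError p (W s) s| * |ξ - ζ| := by
        refine (abs_add_le _ _).trans ?_
        rw [abs_mul, abs_mul (coefficientError p (W s) s)]
        exact add_le_add_left (mul_le_mul_of_nonneg_left (hs ξ ζ hξ hζ) (abs_nonneg _)) _
    _ = (|p * (1 - p) / W s| * (C * s ^ (-(3 / 4) : ℝ)) + |coefficientError p (W s) s|)
          * |ξ - ζ| := by ring
    _ ≤ K * s ^ (-(7 / 4) : ℝ) * |ξ - ζ| :=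
        mul_le_mul_of_nonneg_right ((le_norm_self _).trans hbound) (abs_nonneg _)

theorem eventually_one_add_pos (hW : IsInverseProfile a c W) (b : ℝ) :
    ∀ᶠ s in atTop, ∀ ξ, |ξ| ≤ s ^ (-(3 / 4) : ℝ) → 0 < 1 + (W s)⁻¹ * (b / W s + ξ) := by
  have hsmall : ∀ᶠ s : ℝ in atTop, s ^ (-(3 / 4) : ℝ) ≤ 1 / 2 :=
    (tendsto_rpow_neg_atTop (by norm_num)).eventually_le_const (by norm_num)
  filter_upwards [hW.tendsto_atTop.eventually_ge_atTop 2, hsmall,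
    hW.eventually_abs_div_le b (e := 3 / 4) (by norm_num)] with s hWs hs hb ξ hξ
  have habs : |b / W s + ξ| ≤ 1 := (abs_add_le _ _).trans (by linarith)
  have hinv : (W s)⁻¹ ≤ 1 / 2 := by
    rw [inv_le_comm₀ (by linarith) (by norm_num)]
    linarith
  have hinv₀ : 0 < (W s)⁻¹ := inv_pos.2 (by linarith)
  nlinarith [(abs_le.1 habs).1]

theorem eventually_continuousAt_correctionForcing (hW : IsInverseProfile a c W) (q r p b : ℝ) :
    ∀ᶠ s in atTop, ∀ ξ, |ξ| ≤ s ^ (-(3 / 4) : ℝ) →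
      ContinuousAt (fun z : ℝ × ℝ => correctionForcing q r p a b (W z.1) z.1 z.2) (s, ξ) := by
  filter_upwards [eventually_gt_atTop 0, hW.hasDerivAt, hW.eventually_one_add_pos b,
    hW.tendsto_atTop.eventually_gt_atTop 0, hW.tendsto_atTop.eventually_gt_atTop (-a)]
    with s hs hderiv hpos hWs hWa ξ hξ
  exact continuousAt_correctionForcing q r p a b
    (hderiv.continuousAt.comp_of_eq continuousAt_fst rfl)
    continuousAt_fst continuousAt_snd hWs.ne' (by linarith) hs.ne' (hpos ξ hξ)

end IsInverseProfile

end CorrectionEquation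

section RadialSolution

theorem abs_mul_comp_div_sub_le {Γ : ℝ → ℝ} {m δ L x y : ℝ} (hm : 0 < m)
    (hlip : ∀ ξ ζ, |ξ| ≤ δ → |ζ| ≤ δ → |Γ ξ - Γ ζ| ≤ L * |ξ - ζ|) (hx : |x / m| ≤ δ)
    (hy : |y / m| ≤ δ) : |m * Γ (x / m) - m * Γ (y / m)| ≤ L * |x - y| :=
  calc |m * Γ (x / m) - m * Γ (y / m)|
      = m * |Γ (x / m) - Γ (y / m)| := by rw [← mul_sub, abs_mul, abs_of_pos hm]
    _ ≤ m * (L * |x / m - y / m|) := mul_le_mul_of_nonneg_left (hlip _ _ hx hy) hm.le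
    _ = L * |x - y| := by
        rw [← sub_div, abs_div, abs_of_pos hm]
        field_simp

theorem exists_abs_le_of_lipschitz {Γ : ℝ → ℝ → ℝ} {K θ τ : ℝ} (hK : 0 ≤ K)
    (hzero : (fun s => Γ s 0) =O[atTop] fun s => s ^ (-(τ + θ)))
    (hlip : ∀ᶠ s in atTop, ∀ ξ ζ, |ξ| ≤ s ^ (-θ) → |ζ| ≤ s ^ (-θ) →
      |Γ s ξ - Γ s ζ| ≤ K * s ^ (-τ) * |ξ - ζ|) :
    ∃ C, ∀ᶠ s in atTop, ∀ ξ, |ξ| ≤ s ^ (-θ) → |Γ s ξ| ≤ C * s ^ (-(τ + θ)) := by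
  obtain ⟨C, hC⟩ := hzero.bound
  refine ⟨C + K, ?_⟩
  filter_upwards [hlip, hC, eventually_gt_atTop 0] with s hlip hC hs ξ hξ
  rw [norm_eq_abs, norm_of_nonneg (rpow_nonneg hs.le _)] at hC
  have hdiff := hlip ξ 0 hξ (by simpa using rpow_nonneg hs.le (-θ))
  rw [sub_zero] at hdiff
  calc |Γ s ξ| ≤ |Γ s 0| + |Γ s ξ - Γ s 0| := by
        simpa using abs_add_le (Γ s 0) (Γ s ξ - Γ s 0)
    _ ≤ C * s ^ (-(τ + θ)) + K * s ^ (-τ) * s ^ (-θ) :=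
        add_le_add hC (hdiff.trans
          (mul_le_mul_of_nonneg_left hξ (mul_nonneg hK (rpow_nonneg hs.le _))))
    _ = (C + K) * s ^ (-(τ + θ)) := by
        rw [mul_assoc K, ← rpow_add hs, neg_add, add_mul]

theorem continuousAt_mul_comp_div {m : ℝ → ℝ} {Γ : ℝ → ℝ → ℝ} {s x : ℝ} (hm : ContinuousAt m s)
    (hms : m s ≠ 0) (hΓ : ContinuousAt (Function.uncurry Γ) (s, x / m s)) :
    ContinuousAt (Function.uncurry fun s x => m s * Γ s (x / m s)) (s, x) := by
  have hm₁ : ContinuousAt (fun z : ℝ × ℝ => m z.1) (s, x) :=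
    hm.comp_of_eq continuousAt_fst rfl
  have hpair : ContinuousAt (fun z : ℝ × ℝ => (z.1, z.2 / m z.1)) (s, x) :=
    continuousAt_fst.prodMk (continuousAt_snd.div hm₁ hms)
  exact hm₁.mul (hΓ.comp_of_eq hpair rfl)

theorem exists_abs_mul_le_rpow {m δ : ℝ → ℝ} {Γ : ℝ → ℝ → ℝ} {C e l : ℝ}
    (hm : m =O[atTop] fun s => s ^ l)
    (hΓ : ∀ᶠ s in atTop, ∀ ξ, |ξ| ≤ δ s → |Γ s ξ| ≤ C * s ^ (-e)) :
    ∃ D, ∀ᶠ s in atTop, ∀ ξ, |ξ| ≤ δ s → |m s * Γ s ξ| ≤ D * s ^ (-(e - l)) := by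
  obtain ⟨M, hM₀, hM⟩ := hm.exists_nonneg
  refine ⟨M * C, ?_⟩
  filter_upwards [hΓ, hM.bound, eventually_gt_atTop 0] with s hΓ hM hs ξ hξ
  rw [norm_eq_abs, norm_of_nonneg (rpow_nonneg hs.le _)] at hM
  calc |m s * Γ s ξ| ≤ M * s ^ l * (C * s ^ (-e)) := by
        rw [abs_mul]
        exact mul_le_mul hM (hΓ ξ hξ) (abs_nonneg _) (mul_nonneg hM₀ (rpow_nonneg hs.le _))
    _ = M * C * s ^ (-(e - l)) := by
        rw [mul_mul_mul_comm, ← rpow_add hs]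
        ring_nf

/-- The solution is sought in the window `|η| ≤ m s * s ^ (-θ)` with `θ = 3 / 4`. Any
`θ ∈ (1 / 2, 1)` would do: the forcing then has a Lipschitz constant of order `s ^ (-1 - θ)`,
integrable against the square `s ^ (1 / 2)` of the WKB modes, and the solution, of order `m s / s`,
does not leave the window. -/
theorem exists_weighted_oscillator_solution {m : ℝ → ℝ} {Γ : ℝ → ℝ → ℝ} {k K l : ℝ} (hk : 0 < k)
    (hK : 0 ≤ K) (hl : l < 5 / 4) (hm : ∀ᶠ s in atTop, ContinuousAt m s ∧ 0 < m s)
    (hm_theta : m =Θ[atTop] fun s => s ^ l)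
    (hcont : ∀ᶠ s in atTop, ∀ ξ, |ξ| ≤ s ^ (-(3 / 4) : ℝ) →
      ContinuousAt (Function.uncurry Γ) (s, ξ))
    (hzero : (fun s => Γ s 0) =O[atTop] fun s => s ^ (-(5 / 2) : ℝ))
    (hlip : ∀ᶠ s in atTop, ∀ ξ ζ, |ξ| ≤ s ^ (-(3 / 4) : ℝ) → |ζ| ≤ s ^ (-(3 / 4) : ℝ) →
      |Γ s ξ - Γ s ζ| ≤ K * s ^ (-(7 / 4) : ℝ) * |ξ - ζ|) :
    ∃ η η₁ : ℝ → ℝ, (∀ᶠ s in atTop, |η s / m s| ≤ s ^ (-(3 / 4) : ℝ) ∧ HasDerivAt η (η₁ s) s ∧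
        HasDerivAt η₁ (-(k / s + 3 / 16 / s ^ 2) * η s + m s * Γ s (η s / m s)) s) ∧
      η =O[atTop] fun s => s ^ (l - 1) := by
  obtain ⟨C, hC⟩ := exists_abs_le_of_lipschitz hK
    (hzero.congr_right fun s => by norm_num : _ =O[atTop] fun s => s ^ (-(7 / 4 + 3 / 4) : ℝ)) hlip
  obtain ⟨D, hD⟩ := exists_abs_mul_le_rpow hm_theta.isBigO hC
  have hscale : ∀ᶠ s in atTop, ∀ x, |x| ≤ m s * s ^ (-(3 / 4) : ℝ) →
      |x / m s| ≤ s ^ (-(3 / 4) : ℝ) := by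
    filter_upwards [hm] with s hs x hx
    rwa [abs_div, abs_of_pos hs.2, div_le_iff₀' hs.2]
  have hd : ∀ᶠ s in atTop, ContinuousAt (fun s => m s * s ^ (-(3 / 4) : ℝ)) s ∧
      0 ≤ m s * s ^ (-(3 / 4) : ℝ) := by
    filter_upwards [hm, eventually_gt_atTop 0] with s hs hs₀
    exact ⟨hs.1.mul (continuousAt_id.rpow_const (Or.inl hs₀.ne')),
      mul_nonneg hs.2.le (rpow_nonneg hs₀.le _)⟩
  have hcont' : ∀ᶠ s in atTop, ∀ x, |x| ≤ m s * s ^ (-(3 / 4) : ℝ) →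
      ContinuousAt (Function.uncurry fun s x => m s * Γ s (x / m s)) (s, x) := by
    filter_upwards [hm, hcont, hscale] with s hs hcont hscale x hx
    exact continuousAt_mul_comp_div hs.1 hs.2.ne' (hcont _ (hscale x hx))
  have hlip' : ∀ᶠ s in atTop, ∀ x y, |x| ≤ m s * s ^ (-(3 / 4) : ℝ) →
      |y| ≤ m s * s ^ (-(3 / 4) : ℝ) →
      |m s * Γ s (x / m s) - m s * Γ s (y / m s)| ≤ K * s ^ (-(7 / 4) : ℝ) * |x - y| := by
    filter_upwards [hm, hlip, hscale] with s hs hlip hscale x y hx hy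
    exact abs_mul_comp_div_sub_le hs.2 hlip (hscale x hx) (hscale y hy)
  have hbd : ∀ᶠ s in atTop, ∀ x, |x| ≤ m s * s ^ (-(3 / 4) : ℝ) →
      |m s * Γ s (x / m s)| ≤ D * s ^ (-(5 / 2 - l)) := by
    filter_upwards [hscale, hD] with s hscale hD x hx
    convert hD _ (hscale x hx) using 3
    norm_num
  have hsmall : (fun s : ℝ => s ^ (3 / 2 - (5 / 2 - l))) =o[atTop]
      fun s => m s * s ^ (-(3 / 4) : ℝ) := by
    refine (rpow_isLittleO_rpow_atTop (f := l - 3 / 4) (by linarith)).trans_isBigO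
      ((hm_theta.isBigO_symm.mul (isBigO_refl _ _)).congr' ?_ .rfl)
    filter_upwards [eventually_gt_atTop 0] with s hs
    rw [← rpow_add hs, sub_eq_add_neg]
  obtain ⟨η, η₁, hη, hη_bigO⟩ := exists_oscillator_solution_of_local hk hK (by norm_num)
    (by linarith) hd hcont' hlip' hbd hsmall
  refine ⟨η, η₁, ?_, hη_bigO.congr_right fun s => by ring_nf⟩
  filter_upwards [hη, hscale] with s hs hscale
  exact ⟨hscale _ hs.1, hs.2⟩

end RadialSolution

section RadialProfile

theorem rpow_eq_mul_rpow_sub_one {y : ℝ} (hy : 0 < y) (p : ℝ) : y ^ p = y * y ^ (p - 1) := by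
  rw [rpow_sub_one hy.ne', mul_div_cancel₀ _ hy.ne']

theorem rpow_sub_two_eq_div {y : ℝ} (hy : 0 < y) (p : ℝ) : y ^ (p - 2) = y ^ (p - 1) / y := by
  rw [← rpow_sub_one hy.ne', sub_sub, one_add_one_eq_two]

theorem hasDerivAt_rpow_of_hasDerivAt_div_add {W : ℝ → ℝ} {a s : ℝ}
    (hW : HasDerivAt W (W s / (W s + a)) s) (hpos : 0 < W s) (e : ℝ) :
    HasDerivAt (fun s => W s ^ e) (e * W s ^ e / (W s + a)) s := by
  refine (hW.rpow_const (p := e) (Or.inl hpos.ne')).congr_deriv ?_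
  rw [rpow_sub_one hpos.ne' e]
  field_simp

theorem hasDerivAt_rpow_div_add_of_hasDerivAt_div_add {W : ℝ → ℝ} {a s : ℝ}
    (hW : HasDerivAt W (W s / (W s + a)) s) (hpos : 0 < W s) (ha : W s + a ≠ 0) (e : ℝ) :
    HasDerivAt (fun s => e * W s ^ e / (W s + a))
      (e * W s ^ e * (e / (W s + a) ^ 2 - W s / (W s + a) ^ 3)) s := by
  refine (((hasDerivAt_rpow_of_hasDerivAt_div_add hW hpos e).const_mul e).div
    (hW.add_const a) ha).congr_deriv ?_
  field_simp

/-- The approximate solution `W ^ p + b * W ^ (p - 2)` of the radial equation. -/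
noncomputable def approxSolution (W : ℝ → ℝ) (p b s : ℝ) : ℝ :=
  W s ^ p + b * W s ^ (p - 2)

theorem IsInverseProfile.exists_hasDerivAt_approxSolution {a c : ℝ} {W : ℝ → ℝ}
    (hW : IsInverseProfile a c W) (p b : ℝ) :
    ∃ V₁ : ℝ → ℝ, ∀ᶠ s in atTop, HasDerivAt (approxSolution W p b) (V₁ s) s ∧
      HasDerivAt V₁ (W s ^ (p - 1) * (approxResidual p a b (W s) - p * (1 - p) / W s
        - (1 - p) * b / W s ^ 2)) s := by
  refine ⟨fun s => p * W s ^ p / (W s + a) + b * ((p - 2) * W s ^ (p - 2) / (W s + a)), ?_⟩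
  filter_upwards [hW.hasDerivAt, hW.tendsto_atTop.eventually_gt_atTop 0,
    hW.tendsto_atTop.eventually_gt_atTop (-a)] with s hderiv hpos hWa
  have ha : W s + a ≠ 0 := by linarith
  refine ⟨(hasDerivAt_rpow_of_hasDerivAt_div_add hderiv hpos p).add
    ((hasDerivAt_rpow_of_hasDerivAt_div_add hderiv hpos (p - 2)).const_mul b), ?_⟩
  refine ((hasDerivAt_rpow_div_add_of_hasDerivAt_div_add hderiv hpos ha p).add
    ((hasDerivAt_rpow_div_add_of_hasDerivAt_div_add hderiv hpos ha (p - 2)).const_mul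
      b)).congr_deriv ?_
  rw [rpow_eq_mul_rpow_sub_one hpos p, rpow_sub_two_eq_div hpos p, approxResidual]
  ring

theorem approx_add_correction_eq {y : ℝ} (hy : 0 < y) (p b ξ : ℝ) :
    y ^ p + b * y ^ (p - 2) + y ^ (p - 1) * ξ = y ^ p * (1 + y⁻¹ * (b / y + ξ)) := by
  rw [rpow_eq_mul_rpow_sub_one hy p, rpow_sub_two_eq_div hy p]
  field_simp
  ring

/-- The exact radial equation for `y ^ p + b * y ^ (p - 2) + y ^ (p - 1) * ξ`, where `p = 1 / q`,
split into the second derivative of the approximate solution and the equation of the correction. -/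
theorem neg_nonlinearity_eq_correctionForcing {q r s y b ξ : ℝ} (a : ℝ) (hq : 1 < q) (hy : 0 < y)
    (hys : y + (2 * q + r - 1) / q * log y = s + log (4 * (q - 1) / q ^ 2))
    (hξ : 0 < 1 + y⁻¹ * (b / y + ξ)) :
    -(1 / 4 * exp (-s) * ((y ^ (1 / q) + b * y ^ (1 / q - 2) + y ^ (1 / q - 1) * ξ) ^ r
        * exp ((y ^ (1 / q) + b * y ^ (1 / q - 2) + y ^ (1 / q - 1) * ξ) ^ q))) =
      y ^ (1 / q - 1) * (approxResidual (1 / q) a b y - 1 / q * (1 - 1 / q) / y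
          - (1 - 1 / q) * b / y ^ 2)
        + (-((1 - 1 / q) / s + 3 / 16 / s ^ 2) * (y ^ (1 / q - 1) * ξ)
          + y ^ (1 / q - 1) * correctionForcing q r (1 / q) a b y s ξ) := by
  rw [approx_add_correction_eq hy, exp_neg_mul_nonlinearity_eq hq hy hys hξ, correctionForcing,
    nonlinearRemainder, coefficientError]
  generalize rescaledNonlinearity q r y⁻¹ (b / y + ξ) = g, (1 - 1 / q) / s = k, 3 / 16 / s ^ 2 = d
  field_simp
  ring

theorem IsInverseProfile.exists_radial_solution {q r : ℝ} {W : ℝ → ℝ} (hq : 1 < q)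
    (hW : IsInverseProfile ((2 * q + r - 1) / q) (log (4 * (q - 1) / q ^ 2)) W) :
    ∃ v v₁ : ℝ → ℝ, (∀ᶠ s in atTop, HasDerivAt v (v₁ s) s ∧
        HasDerivAt v₁ (-(1 / 4 * exp (-s) * (v s ^ r * exp (v s ^ q)))) s) ∧
      (fun s => v s - W s ^ (1 / q)) =O[atTop] fun s => s ^ (1 / q - 2) := by
  set a := (2 * q + r - 1) / q
  set p := 1 / q with hp
  have hp_lt : p < 1 := (div_lt_one (by linarith)).2 hq
  set b := -(a * p * (3 - 2 * p)) / (1 - p)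
  have hb : (1 - p) * b = -(a * p * (3 - 2 * p)) := mul_div_cancel₀ _ (by linarith)
  obtain ⟨K, hK, hlip⟩ := hW.exists_abs_correctionForcing_sub_le q r p b
  have hWpos := hW.tendsto_atTop.eventually_gt_atTop 0
  obtain ⟨η, η₁, hη, hη_bigO⟩ := exists_weighted_oscillator_solution
    (m := fun s => W s ^ (p - 1)) (Γ := fun s => correctionForcing q r p a b (W s) s)
    (k := 1 - p) (by linarith) hK (by linarith)
    (by
      filter_upwards [hW.hasDerivAt, hWpos] with s hderiv hpos
      exact ⟨hderiv.continuousAt.rpow_const (Or.inl hpos.ne'), rpow_pos_of_pos hpos _⟩)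
    (hW.isTheta_rpow (p - 1)) (hW.eventually_continuousAt_correctionForcing q r p b)
    (hW.correctionForcing_zero_isBigO q r hb) hlip
  obtain ⟨V₁, hV⟩ := hW.exists_hasDerivAt_approxSolution p b
  refine ⟨fun s => approxSolution W p b s + η s, fun s => V₁ s + η₁ s, ?_, ?_⟩
  · filter_upwards [hV, hη, hWpos, hW.add_log, hW.eventually_one_add_pos b]
      with s hVs ⟨hηs, hη', hη''⟩ hpos hlog hone
    refine ⟨hVs.1.add hη', (hVs.2.add hη'').congr_deriv ?_⟩
    have hscale : W s ^ (p - 1) * (η s / W s ^ (p - 1)) = η s :=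
      mul_div_cancel₀ _ (rpow_pos_of_pos hpos _).ne'
    have h := neg_nonlinearity_eq_correctionForcing a hq hpos hlog (hone _ hηs)
    rw [← hp, hscale] at h
    exact h.symm
  · rw [show p - 1 - 1 = p - 2 by ring] at hη_bigO
    refine (((hW.isTheta_rpow (p - 2)).isBigO.const_mul_left b).add hη_bigO).congr_left fun s => ?_
    simp only [approxSolution]
    ring

theorem exists_radial_solution {q : ℝ} (r : ℝ) (hq : 1 < q) :
    ∃ v v₁ : ℝ → ℝ, (∀ᶠ s in atTop, HasDerivAt v (v₁ s) s ∧
        HasDerivAt v₁ (-(1 / 4 * exp (-s) * (v s ^ r * exp (v s ^ q)))) s) ∧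
      Tendsto v atTop atTop ∧
      (fun s => v s - (s - (2 * q + r - 1) / q * log s + log (4 * (q - 1) / q ^ 2)) ^ (1 / q))
        =O[atTop] fun s => log s / s ^ (2 - 1 / q) := by
  obtain ⟨W, hW⟩ := exists_isInverseProfile ((2 * q + r - 1) / q) (log (4 * (q - 1) / q ^ 2))
  obtain ⟨v, v₁, hv, hvW⟩ := hW.exists_radial_solution hq
  have hp_pos : 0 < 1 / q := by positivity
  have hp_lt : 1 / q < 1 := (div_lt_one (by linarith)).2 hq
  refine ⟨v, v₁, hv, ?_, ?_⟩
  · have hdiff : Tendsto (fun s => v s - W s ^ (1 / q)) atTop (𝓝 0) := by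
      refine hvW.trans_tendsto ?_
      simpa only [neg_sub] using tendsto_rpow_neg_atTop (y := 2 - 1 / q) (by linarith)
    simpa using ((tendsto_rpow_atTop hp_pos).comp hW.tendsto_atTop).atTop_add hdiff
  · have hlog : (fun s : ℝ => s ^ (1 / q - 2)) =O[atTop] fun s => log s / s ^ (2 - 1 / q) := by
      refine .of_bound' ?_
      filter_upwards [eventually_gt_atTop 0, tendsto_log_atTop.eventually_ge_atTop 1]
        with s hs hlog
      rw [← neg_sub 2, rpow_neg hs.le, norm_div, norm_inv, ← one_div]
      gcongr
      exact hlog.trans (le_abs_self _)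
    exact ((hvW.trans hlog).add (hW.rpow_sub_explicit_rpow_isBigO (1 / q))).congr_left
      fun s => by ring

end RadialProfile

section Regularity

theorem contDiffOn_of_hasDerivAt_field {E : Type*} [NormedAddCommGroup E] [NormedSpace ℝ E]
    {F : ℝ × E → E} {Y : ℝ → E} {I : Set ℝ} {Ω : Set (ℝ × E)} (hI : IsOpen I)
    (hF : ContDiffOn ℝ ∞ F Ω) (hY : ∀ s ∈ I, HasDerivAt Y (F (s, Y s)) s)
    (hmem : ∀ s ∈ I, (s, Y s) ∈ Ω) : ContDiffOn ℝ ∞ Y I := by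
  rw [contDiffOn_infty]
  intro n
  induction n with
  | zero =>
    exact contDiffOn_zero.2 fun s hs => (hY s hs).continuousAt.continuousWithinAt
  | succ n ih =>
    push_cast
    rw [contDiffOn_succ_iff_deriv_of_isOpen hI]
    exact ⟨fun s hs => (hY s hs).differentiableAt.differentiableWithinAt, by simp,
      ((contDiffOn_infty.1 hF n).comp (contDiffOn_id.prodMk ih) hmem).congr
        fun s hs => (hY s hs).deriv⟩

theorem contDiffOn_of_hasDerivAt_second_order {g : ℝ × ℝ → ℝ} {v v₁ : ℝ → ℝ} {I : Set ℝ}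
    {Ω : Set (ℝ × ℝ)} (hI : IsOpen I) (hg : ContDiffOn ℝ ∞ g Ω)
    (hv : ∀ s ∈ I, HasDerivAt v (v₁ s) s) (hv₁ : ∀ s ∈ I, HasDerivAt v₁ (g (s, v s)) s)
    (hmem : ∀ s ∈ I, (s, v s) ∈ Ω) : ContDiffOn ℝ ∞ v I := by
  have hproj : ContDiff ℝ ∞ fun z : ℝ × ℝ × ℝ => (z.1, z.2.1) := by fun_prop
  have hfield : ContDiffOn ℝ ∞ (fun z : ℝ × ℝ × ℝ => (z.2.2, g (z.1, z.2.1)))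
      ((fun z => (z.1, z.2.1)) ⁻¹' Ω) :=
    (contDiff_snd.comp contDiff_snd).contDiffOn.prodMk
      (hg.comp hproj.contDiffOn (mapsTo_preimage _ _))
  exact (contDiffOn_of_hasDerivAt_field (Y := fun s => (v s, v₁ s)) hI hfield
    (fun s hs => (hv s hs).prodMk (hv₁ s hs)) hmem).fst

theorem contDiffOn_radialNonlinearity (q r : ℝ) :
    ContDiffOn ℝ ∞ (fun z : ℝ × ℝ => -(1 / 4 * exp (-z.1) * (z.2 ^ r * exp (z.2 ^ q))))
      {z | z.2 ≠ 0} := by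
  have hpow (e : ℝ) : ContDiffOn ℝ ∞ (fun z : ℝ × ℝ => z.2 ^ e) {z | z.2 ≠ 0} :=
    contDiff_snd.contDiffOn.rpow_const_of_ne fun z hz => hz
  have hexp : ContDiff ℝ ∞ fun z : ℝ × ℝ => 1 / 4 * exp (-z.1) := by fun_prop
  exact (hexp.contDiffOn.mul ((hpow r).mul (hpow q).exp)).neg

end Regularity

section Laplacian

theorem tendsto_neg_log_norm_sq {E : Type*} [NormedAddCommGroup E] :
    Tendsto (fun x : E => -log (‖x‖ ^ 2)) (𝓝[≠] 0) atTop := by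
  have hlog : Tendsto (fun x : E => log ‖x‖) (𝓝[≠] 0) atBot :=
    tendsto_log_nhdsGT_zero.comp tendsto_norm_nhdsNE_zero
  simpa [log_pow] using hlog.const_mul_atBot two_pos

variable {E : Type*} [NormedAddCommGroup E] [InnerProductSpace ℝ E] [FiniteDimensional ℝ E]

theorem laplacian_comp_norm_sq {f φ : ℝ → ℝ} {φ' : ℝ} {x : E}
    (hf : ∀ᶠ ρ in 𝓝 (‖x‖ ^ 2), HasDerivAt f (φ ρ) ρ) (hφ : HasDerivAt φ φ' (‖x‖ ^ 2)) :
    Laplacian.laplacian (fun y : E => f (‖y‖ ^ 2)) x =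
      4 * ‖x‖ ^ 2 * φ' + 2 * Module.finrank ℝ E * φ (‖x‖ ^ 2) := by
  let I : E →L[ℝ] E →L[ℝ] ℝ := innerSL ℝ
  have hI (y z : E) : I y z = inner ℝ y z := rfl
  have hnorm (y : E) : HasFDerivAt (fun y : E => ‖y‖ ^ 2) ((2 : ℝ) • I y) y :=
    (hasStrictFDerivAt_norm_sq y).hasFDerivAt.congr_fderiv (ofNat_smul_eq_nsmul ℝ 2 (I y)).symm
  have hfirst : ∀ᶠ y in 𝓝 x, fderiv ℝ (fun y : E => f (‖y‖ ^ 2)) y = (2 * φ (‖y‖ ^ 2)) • I y := by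
    filter_upwards [(hnorm x).continuousAt.eventually hf] with y hy
    exact (hy.comp_hasFDerivAt y (hnorm y)).fderiv.trans (by rw [smul_smul, mul_comm])
  have hsecond : fderiv ℝ (fderiv ℝ fun y : E => f (‖y‖ ^ 2)) x =
      (2 * φ (‖x‖ ^ 2)) • I + ((2 : ℝ) • φ' • (2 : ℝ) • I x).smulRight (I x) :=
    ((((hφ.comp_hasFDerivAt x (hnorm x)).const_mul 2).smul
      I.hasFDerivAt).congr_of_eventuallyEq hfirst).fderiv
  have hdiag (e : E) : iteratedFDeriv ℝ 2 (fun y : E => f (‖y‖ ^ 2)) x ![e, e] =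
      2 * φ (‖x‖ ^ 2) * ‖e‖ ^ 2 + 4 * φ' * inner ℝ x e ^ 2 := by
    simp [iteratedFDeriv_two_apply, hsecond, hI]
    ring
  rw [InnerProductSpace.laplacian_eq_iteratedFDeriv_stdOrthonormalBasis]
  simp only [hdiag, Finset.sum_add_distrib, ← Finset.mul_sum,
    OrthonormalBasis.sum_sq_inner_left, OrthonormalBasis.norm_eq_one]
  simp
  ring

theorem laplacian_comp_neg_log_norm_sq (hE : Module.finrank ℝ E = 2) {v v₁ : ℝ → ℝ} {d : ℝ} {x : E}
    (hx : x ≠ 0) (hv : ∀ᶠ s in 𝓝 (-log (‖x‖ ^ 2)), HasDerivAt v (v₁ s) s)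
    (hv₁ : HasDerivAt v₁ d (-log (‖x‖ ^ 2))) :
    Laplacian.laplacian (fun y : E => v (-log (‖y‖ ^ 2))) x = 4 / ‖x‖ ^ 2 * d := by
  have hρ : 0 < ‖x‖ ^ 2 := by positivity
  have hlog {ρ : ℝ} (hρ : 0 < ρ) : HasDerivAt (fun ρ => -log ρ) (-ρ⁻¹) ρ :=
    (hasDerivAt_log hρ.ne').neg
  have hf : ∀ᶠ ρ in 𝓝 (‖x‖ ^ 2), HasDerivAt (fun ρ => v (-log ρ)) (v₁ (-log ρ) * -ρ⁻¹) ρ := by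
    filter_upwards [eventually_gt_nhds hρ, (hlog hρ).continuousAt.eventually hv] with ρ hρ hv
    exact hv.comp ρ (hlog hρ)
  have hφ : HasDerivAt (fun ρ => v₁ (-log ρ) * -ρ⁻¹) _ (‖x‖ ^ 2) :=
    (hv₁.comp (h := fun ρ => -log ρ) _ (hlog hρ)).mul (hasDerivAt_inv hρ.ne').neg
  rw [laplacian_comp_norm_sq hf hφ, hE]
  field_simp
  simp
  ring

end Laplacian

section SingularSolution

theorem lt_neg_log_norm_sq_of_mem_puncturedDisc {T : ℝ} {x : Plane}
    (hx : x ∈ puncturedDisc (exp (-T / 2))) : T < -log (‖x‖ ^ 2) := by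
  have hlog : log ‖x‖ < -T / 2 :=
    (log_lt_iff_lt_exp (norm_pos_iff.2 hx.2)).2 (mem_ball_zero_iff.1 hx.1)
  rw [log_pow]
  push_cast
  linarith

theorem contDiffOn_comp_neg_log_norm_sq {T : ℝ} {v : ℝ → ℝ} {n : ℕ∞ω}
    (hv : ContDiffOn ℝ n v (Ioi T)) :
    ContDiffOn ℝ n (fun x : Plane => v (-log (‖x‖ ^ 2))) (puncturedDisc (exp (-T / 2))) :=
  hv.comp ((contDiff_norm_sq ℝ).contDiffOn.log fun _ hx =>
      pow_ne_zero 2 (norm_ne_zero_iff.2 hx.2)).neg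
    fun _ hx => lt_neg_log_norm_sq_of_mem_puncturedDisc hx

theorem isSingularSolution_comp_neg_log_norm_sq {f v v₁ : ℝ → ℝ} {T : ℝ}
    (hv : ∀ s > T, HasDerivAt v (v₁ s) s)
    (hv₁ : ∀ s > T, HasDerivAt v₁ (-(1 / 4 * exp (-s) * f (v s))) s)
    (hsmooth : ContDiffOn ℝ 2 v (Ioi T)) (hnonneg : ∀ s > T, 0 ≤ v s)
    (htop : Tendsto v atTop atTop) :
    IsSingularSolution f (exp (-T / 2)) fun x => v (-log (‖x‖ ^ 2)) where
  radius_pos := exp_pos _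
  contDiffOn := contDiffOn_comp_neg_log_norm_sq hsmooth
  nonneg x hx := hnonneg _ (lt_neg_log_norm_sq_of_mem_puncturedDisc hx)
  equation x hx := by
    have hT := lt_neg_log_norm_sq_of_mem_puncturedDisc hx
    have hnorm : 0 < ‖x‖ := norm_pos_iff.2 hx.2
    rw [laplacian_comp_neg_log_norm_sq finrank_euclideanSpace_fin hx.2
      ((eventually_gt_nhds hT).mono hv) (hv₁ _ hT), neg_neg, exp_log (by positivity)]
    field_simp
  tendsto_atTop := htop.comp tendsto_neg_log_norm_sq

theorem log_one_div_norm_sq (x : Plane) : log (1 / ‖x‖ ^ 2) = 2 * -log ‖x‖ := by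
  rw [one_div, log_inv, log_pow]
  push_cast
  ring

theorem log_div_rpow_comp_two_mul_isBigO (e : ℝ) :
    (fun t => log (2 * t) / (2 * t) ^ e) =O[atTop] fun t => log t / t ^ e := by
  refine (((isBigO_log_const_mul_log_atTop 2).mul
    (isBigO_refl (fun t : ℝ => (t ^ e)⁻¹) atTop)).const_mul_left (2 ^ e)⁻¹).congr' ?_ .rfl
  filter_upwards [eventually_ge_atTop 0] with t ht
  rw [mul_rpow two_pos.le ht, div_eq_mul_inv, mul_inv]
  ring

theorem comp_neg_log_norm_sq_sub_singularProfile_isBigO {q r : ℝ} {v : ℝ → ℝ}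
    (hv : (fun s => v s
        - (s - (2 * q + r - 1) / q * log s + log (4 * (q - 1) / q ^ 2)) ^ (1 / q))
      =O[atTop] fun s => log s / s ^ (2 - 1 / q)) :
    (fun x => v (-log (‖x‖ ^ 2)) - singularProfile q r x) =O[𝓝[≠] 0] remainderOrder q := by
  have hlog : Tendsto (fun x : Plane => -log ‖x‖) (𝓝[≠] 0) atTop :=
    tendsto_neg_atBot_atTop.comp (tendsto_log_nhdsGT_zero.comp tendsto_norm_nhdsNE_zero)
  have hprofile : (fun x => v (-log (‖x‖ ^ 2)) - singularProfile q r x) =O[𝓝[≠] 0]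
      fun x => log (-log (‖x‖ ^ 2)) / (-log (‖x‖ ^ 2)) ^ (2 - 1 / q) :=
    (hv.comp_tendsto tendsto_neg_log_norm_sq).congr_left fun x => by
      simp [singularProfile]
  refine hprofile.trans (((log_div_rpow_comp_two_mul_isBigO _).comp_tendsto hlog).congr_left
    fun x => ?_)
  simp [log_pow]

theorem singularProfile_two_one {x : Plane} (hx : log ‖x‖ < 0) :
    singularProfile 2 1 x =
      (-2 * log ‖x‖ - 2 * log (-log ‖x‖) - 2 * log 2) ^ (1 / 2 : ℝ) := by
  rw [singularProfile, log_one_div_norm_sq, log_mul two_ne_zero (neg_ne_zero.2 hx.ne)]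
  norm_num
  ring_nf

theorem remainderOrder_two (x : Plane) :
    remainderOrder 2 x = log (-log ‖x‖) / (-log ‖x‖) ^ (3 / 2 : ℝ) := by
  norm_num [remainderOrder]

theorem exists_smooth_radial_solution {q : ℝ} (r : ℝ) (hq : 1 < q) :
    ∃ (T : ℝ) (v : ℝ → ℝ),
      IsSingularSolution (fun s => s ^ r * exp (s ^ q)) (exp (-T / 2))
        (fun x => v (-log (‖x‖ ^ 2))) ∧
      (∀ s > T, 0 < v s) ∧ ContDiffOn ℝ ∞ v (Ioi T) ∧
      (fun x => v (-log (‖x‖ ^ 2)) - singularProfile q r x) =O[𝓝[≠] 0] remainderOrder q := by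
  obtain ⟨v, v₁, hv, htop, hprofile⟩ := exists_radial_solution r hq
  obtain ⟨T, hT⟩ := eventually_atTop.1 (hv.and (htop.eventually_gt_atTop 0))
  have hderiv : ∀ s > T, HasDerivAt v (v₁ s) s := fun s hs => (hT s hs.le).1.1
  have hderiv₁ : ∀ s > T,
      HasDerivAt v₁ (-(1 / 4 * exp (-s) * (v s ^ r * exp (v s ^ q)))) s :=
    fun s hs => (hT s hs.le).1.2
  have hpos : ∀ s > T, 0 < v s := fun s hs => (hT s hs.le).2
  have hsmooth : ContDiffOn ℝ ∞ v (Ioi T) :=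
    contDiffOn_of_hasDerivAt_second_order isOpen_Ioi (contDiffOn_radialNonlinearity q r) hderiv
      hderiv₁ fun s hs => (hpos s hs).ne'
  exact ⟨T, v, isSingularSolution_comp_neg_log_norm_sq hderiv hderiv₁ (contDiffOn_infty.1 hsmooth 2)
    (fun s hs => (hpos s hs).le) htop, hpos, hsmooth,
    comp_neg_log_norm_sq_sub_singularProfile_isBigO hprofile⟩

end SingularSolution

theorem corollary2p1 :
    (∀ q r : ℝ, 1 < q →
      ∃ (R : ℝ) (u : Plane → ℝ),
        IsSingularSolution (fun s => s ^ r * Real.exp (s ^ q)) R u ∧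
        (∀ x ∈ puncturedDisc R, 0 < u x) ∧
        ContDiffOn ℝ ∞ u (puncturedDisc R) ∧
        (∀ x ∈ puncturedDisc R, ∀ y ∈ puncturedDisc R, ‖x‖ = ‖y‖ → u x = u y) ∧
        (fun x => u x - singularProfile q r x) =O[𝓝[≠] (0 : Plane)] remainderOrder q) ∧
    (∀ x : Plane, 0 < ‖x‖ → ‖x‖ < 1 →
      singularProfile 2 1 x =
          (-2 * Real.log ‖x‖ - 2 * Real.log (-Real.log ‖x‖) - 2 * Real.log 2) ^ (1 / 2 : ℝ) ∧
        remainderOrder 2 x = Real.log (-Real.log ‖x‖) / (-Real.log ‖x‖) ^ (3 / 2 : ℝ)) := by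
  refine ⟨fun q r hq => ?_, fun x hx₀ hx₁ =>
    ⟨singularProfile_two_one (log_neg hx₀ hx₁), remainderOrder_two x⟩⟩
  obtain ⟨T, v, hsol, hpos, hsmooth, hprofile⟩ := exists_smooth_radial_solution r hq
  exact ⟨exp (-T / 2), fun x => v (-log (‖x‖ ^ 2)), hsol,
    fun x hx => hpos _ (lt_neg_log_norm_sq_of_mem_puncturedDisc hx),
    contDiffOn_comp_neg_log_norm_sq hsmooth, fun x _ y _ hxy => by simp only [hxy], hprofile⟩
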